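/- **Setting.** Let $K\ge 3$ be the number of arms. Consider an exponential family of densities $f(x|\eta)=h(x)\exp(\eta^T T(x)-A(\eta))$ with respect to a reference measure, with $h\ge 0$ and $T(x)\in\mathbb R^d$ measurable, $A(\eta)=\log\int h(x)e^{\eta^TT(x)}dx$, parameter set $\Theta=\{\eta\in\mathbb R^d: A(\eta)<\infty\}$, expectation parameter $\kappa(\eta)=E_\eta[T]$, convex conjugate $F(\kappa)=\sup_{\eta\in\Theta}\{\eta^T\kappa-A(\eta)\}$ and dual map $\eta(\kappa)=\nabla F(\kappa)$. Assume that $\Theta$ is open, that $A$ is twice continuously differentiable on $\Theta$, and that $F$ is finite near, and twice continuously differentiable at, each point of $\kappa(\Theta)$. Write $D(\eta\|\eta')$ for the relative entropy of $f(\cdot|\eta)$ with respect to $f(\cdot|\eta')$, and $\mathcal P(K)$ for the probability vectors on $\{1,\dots,K\}$. For an arm $i$ and $\eta_1,\eta_2\in\Theta$ put $$D^*(i,\eta_1,\eta_2)=\max_{\lambda\in\mathcal P(K)}\ \inf_{\eta_1',\eta_2'\in\Theta,\ j\ne i}\big[\lambda(i)D(\eta_1\|\eta_2')+\lambda(j)D(\eta_2\|\eta_1')+(1-\lambda(i)-\lambda(j))D(\eta_2\|\eta_2')\big],$$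 and let $\lambda^*(i,\eta_1,\eta_2)$ be a maximising $\lambda$. Assume that there is $c_K\in(0,1)$ with $\lambda^*(k,\eta_1,\eta_2)(j)\ge c_K$ for all arms $k,j$ and all $\eta_1\ne\eta_2$ in $\Theta$. **Statistic.** Let $A_t$ be the arm pulled and $X_t$ the observation at time $t\ge1$; $N_j^n=\sum_{t\le n}1\{A_t=j\}$, $Y_j^n=\sum_{t\le n}T(X_t)1\{A_t=j\}$, $Y^n=\sum_jY_j^n$. The likelihood under the configuration $(j,\eta_1,\eta_2)$ (odd arm $j$ with parameter $\eta_1$, all other arms with parameter $\eta_2$) is $$f_n(j,\eta_1,\eta_2)=\prod_{t\le n}h(X_t)\cdot\exp\{\eta_1^TY_j^n-N_j^nA(\eta_1)+\eta_2^T(Y^n-Y_j^n)-(n-N_j^n)A(\eta_2)\}.$$ Fix hyper-parameters $\tau\in\mathbb R^d$, $n_0\in\mathbb R$ with $\int_\Theta e^{\tau^T\eta-n_0A(\eta)}d\eta<\infty$, and let $p(\eta)\propto e^{\tau^T\eta-n_0A(\eta)}$ be the corresponding probability density on $\Theta$. The modified GLR statistic is $$Z_{ij}(n)=\log\frac{\int_\Theta\int_\Theta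 f_n(i,\eta_1,\eta_2)\,p(\eta_1)p(\eta_2)\,d\eta_1d\eta_2}{\sup_{\eta_1,\eta_2\in\Theta}f_n(j,\eta_1,\eta_2)}\in[-\infty,\infty],\qquad Z_i(n)=\min_{j\ne i}Z_{ij}(n),$$ with $Z_{ij}(n)=-\infty$ if the supremum is infinite. **Policy.** Fix $0<\gamma\le1$. The non-stopping sluggish modified GLR policy $\tilde\pi_{SM}$ starts with an arbitrary arm $A_1$. At each time $n\ge1$ it draws $i^*(n)$ uniformly from the arms maximising $Z_\cdot(n)$ and tosses an independent Bernoulli($\gamma$) coin $U_{n+1}$. If $U_{n+1}=0$, then $A_{n+1}=A_n$. If $U_{n+1}=1$, then $A_{n+1}$ is drawn from $\lambda^*(i^*(n),\hat\eta_1,\hat\eta_2)$, where with $k=i^*(n)$ the maximum likelihood estimates are $\hat\eta_1=\eta(Y_k^n/N_k^n)$ and $\hat\eta_2=\eta\big((Y^n-Y_k^n)/(n-N_k^n)\big)$; whenever these do not both exist (that is, $N_k^n\in\{0,n\}$ or one of the two averages is not in $\kappa(\Theta)$) or coincide, $A_{n+1}$ is instead drawn from any distribution giving each arm probability at least $c_0$,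 for a fixed $c_0>0$. Given the past and $A_{n+1}$, the observation $X_{n+1}$ has the law of arm $A_{n+1}$; the same holds for $X_1$ given $A_1$. **Proposition.** Let $\psi=(i,\eta_1,\eta_2)$ with $\eta_1\ne\eta_2$ in $\Theta$ be the true configuration: arm $i$ has law $f(\cdot|\eta_1)$ and every other arm has law $f(\cdot|\eta_2)$. Then, under $\tilde\pi_{SM}$, $$\lim_{n\to\infty}\frac{Z_i(n)}n=D^*(i,\eta_1,\eta_2)\quad\text{almost surely.}$$ -/

import Mathlib

open MeasureTheory ProbabilityTheory Filter Topology Finset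
open scoped ENNReal NNReal RealInnerProductSpace

noncomputable section

/-- The data of a `d`-dimensional canonical exponential family on `S`:
densities `h x * exp (⟪η, T x⟫ - A η)` with respect to a reference measure
(Lebesgue measure for densities, counting measure for mass functions). -/
structure ExpFamily (S : Type*) [MeasurableSpace S] (d : ℕ) where
  ref : Measure S
  h : S → ℝ≥0
  T : S → EuclideanSpace ℝ (Fin d)
  measurable_h : Measurable h
  measurable_T : Measurable T

namespace ExpFamily

variable {S : Type*} [MeasurableSpace S] {d K : ℕ} (E : ExpFamily S d)

/-- The set where the log partition function is finite. -/
def natSpace : Set (EuclideanSpace ℝ (Fin d)) :=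
  {η | Integrable (fun x => (E.h x : ℝ) * Real.exp ⟪η, E.T x⟫) E.ref}

/-- The log partition function `A`. -/
def logPartition (η : EuclideanSpace ℝ (Fin d)) : ℝ :=
  Real.log (∫ x, (E.h x : ℝ) * Real.exp ⟪η, E.T x⟫ ∂E.ref)

/-- The density `f(x | η)`. -/
def density (η : EuclideanSpace ℝ (Fin d)) (x : S) : ℝ≥0∞ :=
  (E.h x : ℝ≥0∞) * ENNReal.ofReal (Real.exp (⟪η, E.T x⟫ - E.logPartition η))

/-- The member of the family with natural parameter `η`. -/
def law (η : EuclideanSpace ℝ (Fin d)) : Measure S := E.ref.withDensity (E.density η)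

/-- The expectation parameter `κ(η) = E_η[T]`. -/
def meanParam (η : EuclideanSpace ℝ (Fin d)) : EuclideanSpace ℝ (Fin d) :=
  ∫ x, E.T x ∂E.law η

/-- The set where the convex conjugate of `A` is finite. -/
def conjDomain : Set (EuclideanSpace ℝ (Fin d)) :=
  {κ | BddAbove (Set.range fun η : E.natSpace =>
    ⟪(η : EuclideanSpace ℝ (Fin d)), κ⟫ - E.logPartition η)}

/-- The convex conjugate `F` of `A`. -/
def conj (κ : EuclideanSpace ℝ (Fin d)) : ℝ :=
  ⨆ η : E.natSpace, (⟪(η : EuclideanSpace ℝ (Fin d)), κ⟫ - E.logPartition η)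

/-- The natural parameter dual to an expectation parameter, `η(κ) = ∇F(κ)`. -/
def natParam (κ : EuclideanSpace ℝ (Fin d)) : EuclideanSpace ℝ (Fin d) :=
  gradient E.conj κ

/-- `A` and `F` are twice continuously differentiable: `A` wherever it is finite, `F` at every
expectation parameter of the family (on a neighbourhood of which it is then finite). -/
structure Regular : Prop where
  isOpen_natSpace : IsOpen E.natSpace
  contDiffOn_logPartition : ContDiffOn ℝ 2 E.logPartition E.natSpace
  meanParam_mem : ∀ η ∈ E.natSpace, E.meanParam η ∈ interior E.conjDomain
  contDiffAt_conj : ∀ η ∈ E.natSpace, ContDiffAt ℝ 2 E.conj (E.meanParam η)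

/-- Relative entropy between two members of the family. -/
def relEnt (η η' : EuclideanSpace ℝ (Fin d)) : ℝ :=
  (InformationTheory.klDiv (E.law η) (E.law η')).toReal

/-- The inner minimum in the definition of `D*`, over the alternatives `(j, η'₁, η'₂)`, `j ≠ i`. -/
def allocValue (i : Fin K) (η₁ η₂ : EuclideanSpace ℝ (Fin d)) (w : Fin K → ℝ) : ℝ :=
  ⨅ p : {j : Fin K // j ≠ i} × E.natSpace × E.natSpace,
    (w i * E.relEnt η₁ p.2.2 + w p.1 * E.relEnt η₂ p.2.1
      + (1 - w i - w p.1) * E.relEnt η₂ p.2.2)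

/-- `D*(i, η₁, η₂)`. -/
def Dstar (i : Fin K) (η₁ η₂ : EuclideanSpace ℝ (Fin d)) : ℝ :=
  ⨆ w : stdSimplex ℝ (Fin K), E.allocValue i η₁ η₂ w

/-- `w = λ*(i, η₁, η₂)`: the probability vector `w` attains the maximum defining `D*`. -/
def IsOptAlloc (i : Fin K) (η₁ η₂ : EuclideanSpace ℝ (Fin d)) (w : Fin K → ℝ) : Prop :=
  w ∈ stdSimplex ℝ (Fin K) ∧ IsMaxOn (E.allocValue i η₁ η₂) (stdSimplex ℝ (Fin K)) w

/-- Nontrivial sampling of all `K` arms by the optimal allocations. -/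
def NontrivialSampling (K : ℕ) : Prop :=
  ∃ c ∈ Set.Ioo (0 : ℝ) 1, ∀ (k : Fin K), ∀ η₁ ∈ E.natSpace, ∀ η₂ ∈ E.natSpace, η₁ ≠ η₂ →
    ∀ w : Fin K → ℝ, E.IsOptAlloc k η₁ η₂ w → ∀ j, c ≤ w j

/-! Statistics of a trajectory: `a t` is the arm pulled and `x t` the observation at time `t ≥ 1`
(the values at `t = 0` are not used). -/

/-- `N_j^n`. -/
def count (a : ℕ → Fin K) (n : ℕ) (j : Fin K) : ℕ := #{t ∈ Finset.Icc 1 n | a t = j}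

/-- `Y_j^n`. -/
def armSum (a : ℕ → Fin K) (x : ℕ → S) (n : ℕ) (j : Fin K) : EuclideanSpace ℝ (Fin d) :=
  ∑ t ∈ Finset.Icc 1 n with a t = j, E.T (x t)

/-- `Y^n`. -/
def totalSum (a : ℕ → Fin K) (x : ℕ → S) (n : ℕ) : EuclideanSpace ℝ (Fin d) :=
  ∑ j, E.armSum a x n j

/-- The likelihood of the first `n` observations under the configuration `(j, η₁, η₂)`. -/
def likelihood (a : ℕ → Fin K) (x : ℕ → S) (n : ℕ) (j : Fin K)
    (η₁ η₂ : EuclideanSpace ℝ (Fin d)) : ℝ≥0∞ :=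
  (∏ t ∈ Finset.Icc 1 n, (E.h (x t) : ℝ≥0∞))
    * ENNReal.ofReal (Real.exp (⟪η₁, E.armSum a x n j⟫ - count a n j * E.logPartition η₁))
    * ENNReal.ofReal (Real.exp (⟪η₂, E.totalSum a x n - E.armSum a x n j⟫
        - ((n : ℝ) - count a n j) * E.logPartition η₂))

/-- `∫ exp (⟪τ, η⟫ - n₀ A(η)) dη`, the reciprocal of the normalising factor of the prior. -/
def priorMass (τ : EuclideanSpace ℝ (Fin d)) (n₀ : ℝ) : ℝ≥0∞ :=
  ∫⁻ η in E.natSpace, ENNReal.ofReal (Real.exp (⟪τ, η⟫ - n₀ * E.logPartition η))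

/-- The conjugate prior density `f(η | τ, n₀)`. -/
def prior (τ : EuclideanSpace ℝ (Fin d)) (n₀ : ℝ) (η : EuclideanSpace ℝ (Fin d)) : ℝ≥0∞ :=
  (E.priorMass τ n₀)⁻¹ * ENNReal.ofReal (Real.exp (⟪τ, η⟫ - n₀ * E.logPartition η))

/-- The averaged likelihood under `H = i`. -/
def avgLikelihood (τ : EuclideanSpace ℝ (Fin d)) (n₀ : ℝ) (a : ℕ → Fin K) (x : ℕ → S)
    (n : ℕ) (i : Fin K) : ℝ≥0∞ :=
  ∫⁻ η₁ in E.natSpace, ∫⁻ η₂ in E.natSpace,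
    E.likelihood a x n i η₁ η₂ * E.prior τ n₀ η₁ * E.prior τ n₀ η₂

/-- The maximum likelihood under `H = j`. -/
def maxLikelihood (a : ℕ → Fin K) (x : ℕ → S) (n : ℕ) (j : Fin K) : ℝ≥0∞ :=
  ⨆ η₁ ∈ E.natSpace, ⨆ η₂ ∈ E.natSpace, E.likelihood a x n j η₁ η₂

/-- The modified GLR `Z_{ij}(n)`; it is `-∞` if the likelihood under `H = j` is unbounded. -/
def pairGLR (τ : EuclideanSpace ℝ (Fin d)) (n₀ : ℝ) (a : ℕ → Fin K) (x : ℕ → S)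
    (n : ℕ) (i j : Fin K) : EReal :=
  ENNReal.log (E.avgLikelihood τ n₀ a x n i / E.maxLikelihood a x n j)

/-- `Z_i(n) = min_{j ≠ i} Z_{ij}(n)`. -/
def GLR (τ : EuclideanSpace ℝ (Fin d)) (n₀ : ℝ) (a : ℕ → Fin K) (x : ℕ → S)
    (n : ℕ) (i : Fin K) : EReal :=
  ⨅ j : {j : Fin K // j ≠ i}, E.pairGLR τ n₀ a x n i j

open scoped Classical in
/-- The arms of largest modified GLR at time `n`. -/
def leaders (τ : EuclideanSpace ℝ (Fin d)) (n₀ : ℝ) (a : ℕ → Fin K) (x : ℕ → S)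
    (n : ℕ) : Finset (Fin K) :=
  {m | ∀ k, E.GLR τ n₀ a x n k ≤ E.GLR τ n₀ a x n m}

/-- The ML estimate of the odd arm's expectation parameter under `H = j`. -/
def oddMean (a : ℕ → Fin K) (x : ℕ → S) (n : ℕ) (j : Fin K) : EuclideanSpace ℝ (Fin d) :=
  (count a n j : ℝ)⁻¹ • E.armSum a x n j

/-- The ML estimate of the other arms' expectation parameter under `H = j`. -/
def restMean (a : ℕ → Fin K) (x : ℕ → S) (n : ℕ) (j : Fin K) : EuclideanSpace ℝ (Fin d) :=
  ((n : ℝ) - count a n j)⁻¹ • (E.totalSum a x n - E.armSum a x n j)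

/-- Under `H = j` both ML estimates of the natural parameters exist, and they are different. -/
def EstimatesOK (a : ℕ → Fin K) (x : ℕ → S) (n : ℕ) (j : Fin K) : Prop :=
  0 < count a n j ∧ count a n j < n ∧
  E.oddMean a x n j ∈ E.meanParam '' E.natSpace ∧
  E.restMean a x n j ∈ E.meanParam '' E.natSpace ∧
  E.natParam (E.oddMean a x n j) ≠ E.natParam (E.restMean a x n j)

end ExpFamily

section Policy

variable {Ω S : Type*} [MeasurableSpace S] {K : ℕ}

/-- The information at time `n` before the leader `I n` is drawn: arms, observations and
coins up to time `n`, and the leaders drawn before time `n`. -/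
@[reducible]
def pastField (A : ℕ → Ω → Fin K) (X : ℕ → Ω → S) (U : ℕ → Ω → Bool) (I : ℕ → Ω → Fin K)
    (n : ℕ) : MeasurableSpace Ω :=
  (⨆ t ∈ Finset.Icc 1 n, ((⊤ : MeasurableSpace (Fin K)).comap (A t)
      ⊔ MeasurableSpace.comap (X t) inferInstance ⊔ (⊤ : MeasurableSpace Bool).comap (U t)))
    ⊔ ⨆ t ∈ Finset.Ico 1 n, (⊤ : MeasurableSpace (Fin K)).comap (I t)

/-- The same information together with the leader `I n`. -/
@[reducible]
def leaderField (A : ℕ → Ω → Fin K) (X : ℕ → Ω → S) (U : ℕ → Ω → Bool) (I : ℕ → Ω → Fin K)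
    (n : ℕ) : MeasurableSpace Ω :=
  pastField A X U I n ⊔ (⊤ : MeasurableSpace (Fin K)).comap (I n)

/-- Everything that precedes the observation `X (n + 1)`. -/
@[reducible]
def pullField (A : ℕ → Ω → Fin K) (X : ℕ → Ω → S) (U : ℕ → Ω → Bool) (I : ℕ → Ω → Fin K)
    (n : ℕ) : MeasurableSpace Ω :=
  leaderField A X U I n ⊔ (⊤ : MeasurableSpace Bool).comap (U (n + 1))
    ⊔ (⊤ : MeasurableSpace (Fin K)).comap (A (n + 1))

variable [MeasurableSpace Ω] {d : ℕ}

/-- Arms `A t`, observations `X t`, coins `U t` and leaders `I t` generated by the non-stopping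
sluggish modified GLR policy with switching parameter `γ` when the true configuration is
`(i, η₁, η₂)`. `Q n` is the distribution from which a new arm is drawn after time `n`. The first
arm is arbitrary. Where the ML estimates do not exist or coincide, `λ*` at the estimates is
not determined, and `Q n` may then be any distribution with all masses at least `c₀`. -/
structure FollowsSluggishGLR (E : ExpFamily S d) (τ : EuclideanSpace ℝ (Fin d)) (n₀ γ c₀ : ℝ)
    (i : Fin K) (η₁ η₂ : EuclideanSpace ℝ (Fin d)) (P : Measure Ω)
    (A : ℕ → Ω → Fin K) (X : ℕ → Ω → S) (U : ℕ → Ω → Bool) (I : ℕ → Ω → Fin K)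
    (Q : ℕ → Ω → Fin K → ℝ) : Prop where
  measurable_A : ∀ n, Measurable (A n)
  measurable_X : ∀ n, Measurable (X n)
  measurable_U : ∀ n, Measurable (U n)
  measurable_I : ∀ n, Measurable (I n)
  /-- The observation at time `n + 1` has the law of the arm pulled. -/
  observe : ∀ n, ∀ B : Set S, MeasurableSet B →
    P⟦X (n + 1) ⁻¹' B | pullField A X U I n⟧ =ᵐ[P]
      fun ω => (E.law (if A (n + 1) ω = i then η₁ else η₂)).real B
  /-- The leader is uniform among the arms of largest modified GLR. -/
  leader : ∀ n, 1 ≤ n → ∀ m : Fin K,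
    P⟦I n ⁻¹' {m} | pastField A X U I n⟧ =ᵐ[P]
      fun ω => if m ∈ E.leaders τ n₀ (A · ω) (X · ω) n then
        ((#(E.leaders τ n₀ (A · ω) (X · ω) n) : ℕ) : ℝ)⁻¹ else 0
  /-- The coin shows `1` with probability `γ`, independently of the past. -/
  coin : ∀ n, 1 ≤ n →
    P⟦U (n + 1) ⁻¹' {true} | leaderField A X U I n⟧ =ᵐ[P] fun _ => γ
  /-- If the coin shows `0`, the same arm is pulled again. -/
  stay : ∀ n, 1 ≤ n → ∀ᵐ ω ∂P, U (n + 1) ω = false → A (n + 1) ω = A n ω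
  /-- If the coin shows `1`, the next arm is drawn from `Q n`. -/
  draw : ∀ n, 1 ≤ n → ∀ b : Fin K,
    P⟦U (n + 1) ⁻¹' {true} ∩ A (n + 1) ⁻¹' {b} | leaderField A X U I n⟧ =ᵐ[P]
      fun ω => γ * Q n ω b
  Q_mem : ∀ n, 1 ≤ n → ∀ ω, Q n ω ∈ stdSimplex ℝ (Fin K)
  /-- `Q n` is `λ*` at the current leader and its ML estimates. -/
  Q_opt : ∀ n, 1 ≤ n → ∀ ω, E.EstimatesOK (A · ω) (X · ω) n (I n ω) →
    E.IsOptAlloc (I n ω) (E.natParam (E.oddMean (A · ω) (X · ω) n (I n ω)))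
      (E.natParam (E.restMean (A · ω) (X · ω) n (I n ω))) (Q n ω)
  Q_default : ∀ n, 1 ≤ n → ∀ ω, ¬ E.EstimatesOK (A · ω) (X · ω) n (I n ω) →
    ∀ b, c₀ ≤ Q n ω b

end Policy

end

/-!
Why the statistic of the true odd arm grows at the rate `D*`.

*Duality.* Gibbs' inequality says that the conjugate `F` is attained at `η` for the mean parameter
`κ(η)`; as `F` is differentiable there, `η` is its gradient, so `natParam` inverts `meanParam`
(`Regular.natParam_meanParam`). The mean parameters contain a neighbourhood of each of their points
(`Regular.image_meanParam_mem_nhds`), so consistent estimates eventually exist, and `F` is strictly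
convex between two of them (`Regular.conj_lt_of_ne`). Call `profile w u j` the maximal
log-likelihood per observation under the hypothesis that `j` is odd, when arm `l` has frequency
`w l` and empirical mean `u l`; it is an explicit expression in `F`. At the true means, the value
`allocValue` of `w` is the least difference between the profile of the true hypothesis and the
profile of another one (`Regular.le_allocValue_iff`).

*One trajectory.* Suppose that all frequencies stay away from `0` and all empirical means converge.
The likelihood averaged over the prior is of the exponential order of the maximal likelihood, so
`Z_i(n) / n` differs from the value of the frequencies at time `n` by `o(1)`
(`Regular.eventually_GLR_bounds`). This value is bounded below by a positive constant, whence the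
true arm is eventually the only leader (`Regular.eventually_leaders`), and new arms are drawn from
allocations that are optimal for consistent estimates. The values of these allocations tend to `D*`
(`Regular.tendsto_allocValue_of_isOptAlloc`). The frequencies follow the averages of the
allocations, and the value is concave, so the values of the frequencies tend to `D*` as well
(`tendsto_allocValue_of_average`). The optimal allocation need not be known to be unique.

*Probability.* The conditions on the trajectory hold almost surely by a strong law of large numbers
for square-integrable martingale differences (`ae_tendsto_average_martingaleDifference`), applied
to the draws of the arms (`FollowsSluggishGLR.ae_tendsto_freq_sub`) and to the observations of each
arm (`FollowsSluggishGLR.ae_tendsto_average_obs`).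
-/

/-! ### A strong law for square-integrable martingale differences -/

/-- Kronecker's lemma for the weights `1 / (t + 1)`. -/
lemma tendsto_average_of_tendsto_sum_div {x : ℕ → ℝ} {s : ℝ}
    (h : Tendsto (fun n => ∑ t ∈ range n, x t / (t + 1)) atTop (𝓝 s)) :
    Tendsto (fun n : ℕ => (n : ℝ)⁻¹ * ∑ t ∈ range n, x t) atTop (𝓝 0) := by
  set S : ℕ → ℝ := fun n => ∑ t ∈ range n, x t / (t + 1) with hS
  -- summation by parts
  have key : ∀ n : ℕ, ∑ t ∈ range n, x t = n * S n - ∑ t ∈ range n, S t := by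
    intro n
    induction n with
    | zero => simp
    | succ n ih =>
      have h1 : S (n + 1) = S n + x n / (n + 1) := by simp [hS, sum_range_succ]
      have h2 : (n : ℝ) + 1 ≠ 0 := by positivity
      rw [sum_range_succ, ih, sum_range_succ, h1]
      push_cast
      field_simp
      ring
  have h3 := h.sub h.cesaro
  rw [sub_self] at h3
  refine h3.congr' ?_
  filter_upwards [eventually_gt_atTop 0] with n hn
  have : (n : ℝ) ≠ 0 := by positivity
  rw [key n, mul_sub, inv_mul_cancel_left₀ this]

lemma sum_one_div_add_one_sq_le (n : ℕ) : ∑ t ∈ range n, (1 / ((t : ℝ) + 1)) ^ 2 ≤ 2 := by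
  have h := sum_Ioo_inv_sq_le (α := ℝ) 0 (n + 1)
  have e : ∑ t ∈ range n, (1 / ((t : ℝ) + 1)) ^ 2 = ∑ i ∈ Ioo 0 (n + 1), ((i : ℝ) ^ 2)⁻¹ := by
    have : Ioo 0 (n + 1) = (range n).image (· + 1) := by
      ext k; simp only [mem_Ioo, mem_image, mem_range]
      exact ⟨fun h => ⟨k - 1, by omega, by omega⟩, by rintro ⟨a, h, rfl⟩; omega⟩
    rw [this, sum_image (by simp)]
    simp
  rw [e]; simpa using h

section StrongLaw

variable {Ω : Type*} {m0 : MeasurableSpace Ω} {P : Measure Ω}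

lemma integral_sq_sum_martingaleDifference_le [IsProbabilityMeasure P] {ℱ : Filtration ℕ m0}
    {D : ℕ → Ω → ℝ} {C : ℝ} (hD : ∀ t, StronglyMeasurable[ℱ (t + 1)] (D t))
    (hL2 : ∀ t, MemLp (D t) 2 P) (hC : ∀ t, ∫ ω, D t ω ^ 2 ∂P ≤ C)
    (h0 : ∀ t, P[D t | ℱ t] =ᵐ[P] 0) (c : ℕ → ℝ) (n : ℕ) :
    ∫ ω, (∑ t ∈ range n, D t ω * c t) ^ 2 ∂P ≤ C * ∑ t ∈ range n, c t ^ 2 := by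
  induction n with
  | zero => simp
  | succ n ih =>
    set M : Ω → ℝ := fun ω => ∑ t ∈ range n, D t ω * c t with hM
    have hM2 : MemLp M 2 P := memLp_finsetSum _ fun t _ => (hL2 t).mul_const (c t)
    have hMm : StronglyMeasurable[ℱ n] M := by
      refine Finset.stronglyMeasurable_fun_sum _ fun t ht => ?_
      exact ((hD t).mono (ℱ.mono (by have := mem_range.1 ht; omega))).mul_const _
    have hMD : Integrable (M * D n) P := hM2.integrable_mul (hL2 n)
    -- the new increment is orthogonal to the past
    have horth : ∫ ω, M ω * D n ω ∂P = 0 := by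
      have h1 : P[M * D n | ℱ n] =ᵐ[P] 0 := by
        filter_upwards [condExp_mul_of_stronglyMeasurable_left hMm hMD
          ((hL2 n).integrable (by norm_num)), h0 n] with ω h2 h3
        simp [h2, h3]
      have h2 := integral_condExp (μ := P) (f := M * D n) (ℱ.le n)
      rw [integral_congr_ae h1] at h2
      simpa using h2.symm
    have e : ∀ ω, (∑ t ∈ range (n + 1), D t ω * c t) ^ 2
        = M ω ^ 2 + (2 * c n * (M ω * D n ω) + c n ^ 2 * D n ω ^ 2) := by
      intro ω
      rw [sum_range_succ, hM]; ring
    simp_rw [e]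
    have i1 : Integrable (fun ω => M ω ^ 2) P := hM2.integrable_sq
    have i2 : Integrable (fun ω => 2 * c n * (M ω * D n ω)) P := hMD.const_mul _
    have i3 : Integrable (fun ω => c n ^ 2 * D n ω ^ 2) P := (hL2 n).integrable_sq.const_mul _
    have i23 : Integrable (fun ω => 2 * c n * (M ω * D n ω) + c n ^ 2 * D n ω ^ 2) P := i2.add i3
    rw [integral_add i1 i23, integral_add i2 i3, integral_const_mul, integral_const_mul,
      horth, sum_range_succ, mul_add]
    have := mul_le_mul_of_nonneg_left (hC n) (sq_nonneg (c n))
    linarith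

/-- Strong law of large numbers for martingale differences with bounded second moments: the
weighted sums `∑ D t / (t + 1)` form a martingale bounded in `L²`, hence converge. -/
theorem ae_tendsto_average_martingaleDifference [IsProbabilityMeasure P] {ℱ : Filtration ℕ m0}
    {D : ℕ → Ω → ℝ} {C : ℝ} (hD : ∀ t, StronglyMeasurable[ℱ (t + 1)] (D t))
    (hL2 : ∀ t, MemLp (D t) 2 P) (hC : ∀ t, ∫ ω, D t ω ^ 2 ∂P ≤ C)
    (h0 : ∀ t, P[D t | ℱ t] =ᵐ[P] 0) :
    ∀ᵐ ω ∂P, Tendsto (fun n : ℕ => (n : ℝ)⁻¹ * ∑ t ∈ range n, D t ω) atTop (𝓝 0) := by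
  set M : ℕ → Ω → ℝ := fun n ω => ∑ t ∈ range n, D t ω * (1 / ((t : ℝ) + 1)) with hM
  have hM2 : ∀ n, MemLp (M n) 2 P := fun n =>
    memLp_finsetSum _ fun t _ => (hL2 t).mul_const _
  have hmart : Martingale M ℱ P := by
    refine martingale_of_condExp_sub_eq_zero_nat ?_ ?_ ?_
    · intro n
      refine Finset.stronglyMeasurable_fun_sum _ fun t ht => ?_
      exact ((hD t).mono (ℱ.mono (by have := mem_range.1 ht; omega))).mul_const _
    · exact fun n => (hM2 n).integrable (by norm_num)
    · intro n
      have e : M (n + 1) - M n = (1 / ((n : ℝ) + 1)) • D n := by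
        ext ω; simp [hM, sum_range_succ, mul_comm]
      rw [e]
      filter_upwards [condExp_smul (1 / ((n : ℝ) + 1)) (D n) (ℱ n) (μ := P), h0 n] with ω h1 h2
      rw [h1, Pi.smul_apply, h2]; simp
  have hC0 : 0 ≤ C := (integral_nonneg fun ω => sq_nonneg _).trans (hC 0)
  have hbound : ∀ n, eLpNorm (M n) 1 P ≤ (Real.toNNReal (1 + C * 2) : ℝ≥0) := by
    intro n
    rw [eLpNorm_one_eq_lintegral_enorm, ← ofReal_integral_norm_eq_lintegral_enorm
      ((hM2 n).integrable (by norm_num))]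
    refine ENNReal.ofReal_le_ofReal ?_
    have h1 : ∫ ω, ‖M n ω‖ ∂P ≤ ∫ ω, (1 + M n ω ^ 2) ∂P := by
      refine integral_mono ((hM2 n).integrable (by norm_num)).norm
        ((integrable_const _).add (hM2 n).integrable_sq) fun ω => ?_
      simp only [Real.norm_eq_abs]
      nlinarith [sq_abs (M n ω), sq_nonneg (|M n ω| - 1), abs_nonneg (M n ω)]
    rw [integral_add (integrable_const _) (hM2 n).integrable_sq] at h1
    have h2 := integral_sq_sum_martingaleDifference_le hD hL2 hC h0
      (fun t => 1 / ((t : ℝ) + 1)) n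
    have h5 := mul_le_mul_of_nonneg_left (sum_one_div_add_one_sq_le n) hC0
    simp only [integral_const, probReal_univ, smul_eq_mul, mul_one] at h1
    linarith
  filter_upwards [hmart.submartingale.ae_tendsto_limitProcess hbound] with ω hω
  exact tendsto_average_of_tendsto_sum_div (hω.congr fun n => by simp [hM, div_eq_mul_inv])

end StrongLaw

namespace ExpFamily

variable {S : Type*} [MeasurableSpace S] {d : ℕ} {E : ExpFamily S d}
  {η η' κ : EuclideanSpace ℝ (Fin d)}

/-! ### Laws, moments and relative entropies of the family -/

lemma measurable_density (η : EuclideanSpace ℝ (Fin d)) : Measurable (E.density η) := by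
  have := E.measurable_h
  have := E.measurable_T
  unfold density
  fun_prop

/-- The reference measure is not concentrated on `{h = 0}`: otherwise the mean parameter `0`
would be the only point where the conjugate is finite. -/
lemma Regular.not_ae_h_eq_zero (hE : E.Regular) (hη : η ∈ E.natSpace) (hne : η ≠ η') :
    ¬ ∀ᵐ x ∂E.ref, E.h x = 0 := by
  intro h0
  have hint : ∀ θ : EuclideanSpace ℝ (Fin d),
      (fun x => (E.h x : ℝ) * Real.exp ⟪θ, E.T x⟫) =ᵐ[E.ref] 0 := fun θ => by
    filter_upwards [h0] with x hx
    simp [hx]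
  have hmem : ∀ θ, θ ∈ E.natSpace := fun θ =>
    (integrable_congr (hint θ)).2 (integrable_zero _ _ _)
  have hA : ∀ θ, E.logPartition θ = 0 := fun θ => by
    simp [logPartition, integral_congr_ae (hint θ)]
  have hlaw : E.law η = 0 := by
    rw [law, withDensity_eq_zero_iff (measurable_density η).aemeasurable]
    filter_upwards [h0] with x hx
    simp [density, hx]
  have hκ : E.meanParam η = 0 := by simp [meanParam, hlaw]
  have hnhds : E.conjDomain ∈ 𝓝 (0 : EuclideanSpace ℝ (Fin d)) := by
    rw [← hκ]; exact mem_interior_iff_mem_nhds.1 (hE.meanParam_mem η hη)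
  set v := η - η' with hv
  have hv0 : 0 < ⟪v, v⟫ := real_inner_self_pos.2 (sub_ne_zero.2 hne)
  have hcont : Tendsto (fun t : ℝ => t • v) (𝓝[>] 0) (𝓝 0) := by
    have : Continuous fun t : ℝ => t • v := by fun_prop
    simpa using (this.tendsto 0).mono_left nhdsWithin_le_nhds
  obtain ⟨t, ht, ht0⟩ := ((hcont.eventually hnhds).and self_mem_nhdsWithin).exists
  obtain ⟨b, hb⟩ := ht
  have h1 := hb ⟨⟨((|b| + 1) / (t * ⟪v, v⟫)) • v, hmem _⟩, rfl⟩
  have ht0 : 0 < t := ht0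
  simp only [hA, inner_smul_left, inner_smul_right, sub_zero] at h1
  simp only [RCLike.conj_to_real] at h1
  have h2 : t * ((|b| + 1) / (t * ⟪v, v⟫) * ⟪v, v⟫) = |b| + 1 := by
    field_simp
  rw [h2] at h1
  linarith [le_abs_self b]

lemma partition_pos (h0 : ¬ ∀ᵐ x ∂E.ref, E.h x = 0) (hη : η ∈ E.natSpace) :
    0 < ∫ x, (E.h x : ℝ) * Real.exp ⟪η, E.T x⟫ ∂E.ref := by
  have hnn : ∀ x, 0 ≤ (E.h x : ℝ) * Real.exp ⟪η, E.T x⟫ := fun x => by positivity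
  refine lt_of_le_of_ne (integral_nonneg hnn) fun h => h0 ?_
  have := (integral_eq_zero_iff_of_nonneg hnn hη).1 h.symm
  filter_upwards [this] with x hx
  simpa [Real.exp_ne_zero] using hx

lemma isProbabilityMeasure_law (h0 : ¬ ∀ᵐ x ∂E.ref, E.h x = 0) (hη : η ∈ E.natSpace) :
    IsProbabilityMeasure (E.law η) := by
  constructor
  have hpos := partition_pos h0 hη
  have e : ∀ x, E.density η x = ENNReal.ofReal
      ((E.h x : ℝ) * Real.exp ⟪η, E.T x⟫ * Real.exp (-E.logPartition η)) := fun x => by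
    rw [density, sub_eq_add_neg, Real.exp_add, mul_assoc, ENNReal.ofReal_mul (E.h x).coe_nonneg,
      ENNReal.ofReal_coe_nnreal]
  rw [law, withDensity_apply _ MeasurableSet.univ, Measure.restrict_univ]
  simp_rw [e]
  rw [← ofReal_integral_eq_lintegral_ofReal (hη.mul_const _) (ae_of_all _ fun x => by positivity),
    integral_mul_const, Real.exp_neg, logPartition, Real.exp_log hpos, mul_inv_cancel₀ hpos.ne',
    ENNReal.ofReal_one]

/-- The likelihood ratio of `η` with respect to `η'`. -/
lemma law_eq_withDensity (η η' : EuclideanSpace ℝ (Fin d)) :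
    E.law η = (E.law η').withDensity fun x => ENNReal.ofReal
      (Real.exp (⟪η - η', E.T x⟫ - (E.logPartition η - E.logPartition η'))) := by
  have hT := E.measurable_T
  have hm : Measurable fun x => ENNReal.ofReal
      (Real.exp (⟪η - η', E.T x⟫ - (E.logPartition η - E.logPartition η'))) := by fun_prop
  rw [law, law, ← withDensity_mul _ (measurable_density η') hm]
  congr 1
  ext x
  simp only [density, Pi.mul_apply]
  rw [mul_assoc, ← ENNReal.ofReal_mul (Real.exp_pos _).le, ← Real.exp_add, inner_sub_left]
  congr 4
  ring

lemma law_absolutelyContinuous (η η' : EuclideanSpace ℝ (Fin d)) : E.law η ≪ E.law η' := by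
  rw [law_eq_withDensity η η']
  exact withDensity_absolutelyContinuous _ _

lemma integrable_exp_inner_law (h0 : ¬ ∀ᵐ x ∂E.ref, E.h x = 0) (hη : η ∈ E.natSpace) :
    Integrable (fun x => Real.exp (⟪η - η', E.T x⟫ - (E.logPartition η - E.logPartition η')))
      (E.law η') ∧
    ∫ x, Real.exp (⟪η - η', E.T x⟫ - (E.logPartition η - E.logPartition η')) ∂E.law η' = 1 := by
  have hT := E.measurable_T
  have := isProbabilityMeasure_law h0 hη
  have h1 : ∫⁻ x, ENNReal.ofReal (Real.exp (⟪η - η', E.T x⟫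
      - (E.logPartition η - E.logPartition η'))) ∂E.law η' = 1 := by
    have h := measure_univ (μ := E.law η)
    rwa [law_eq_withDensity η η', withDensity_apply _ MeasurableSet.univ,
      Measure.restrict_univ] at h
  have hm : Measurable fun x => Real.exp (⟪η - η', E.T x⟫
      - (E.logPartition η - E.logPartition η')) := by fun_prop
  have hnn := ae_of_all (E.law η') fun x => (Real.exp_pos (⟪η - η', E.T x⟫
      - (E.logPartition η - E.logPartition η'))).le
  refine ⟨⟨hm.aestronglyMeasurable, ?_⟩, ?_⟩
  · rw [hasFiniteIntegral_iff_ofReal hnn, h1]; exact ENNReal.one_lt_top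
  · rw [integral_eq_lintegral_of_nonneg_ae hnn hm.aestronglyMeasurable, h1, ENNReal.toReal_one]

lemma integrable_exp_mul_inner (h0 : ¬ ∀ᵐ x ∂E.ref, E.h x = 0) (v : EuclideanSpace ℝ (Fin d))
    {t : ℝ} (ht : η + t • v ∈ E.natSpace) :
    Integrable (fun x => Real.exp (t * ⟪v, E.T x⟫)) (E.law η) ∧
    cgf (fun x => ⟪v, E.T x⟫) (E.law η) t = E.logPartition (η + t • v) - E.logPartition η := by
  obtain ⟨h1, h2⟩ := integrable_exp_inner_law (η' := η) h0 ht
  set c := E.logPartition (η + t • v) - E.logPartition η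
  have e : ∀ x, Real.exp (⟪η + t • v - η, E.T x⟫ - c)
      = Real.exp (t * ⟪v, E.T x⟫) * Real.exp (-c) := fun x => by
    rw [add_sub_cancel_left, real_inner_smul_left, sub_eq_add_neg, Real.exp_add]
  simp_rw [e] at h1 h2
  refine ⟨(integrable_mul_const_iff (Real.exp_pos _).ne'.isUnit _).1 h1, ?_⟩
  rw [integral_mul_const] at h2
  have h3 : ∫ x, Real.exp (t * ⟪v, E.T x⟫) ∂E.law η = Real.exp c := by
    rw [Real.exp_neg] at h2
    exact (mul_inv_eq_one₀ (Real.exp_pos c).ne').1 h2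
  rw [cgf, mgf, h3, Real.log_exp]

lemma Regular.zero_mem_interior_integrableExpSet (hE : E.Regular)
    (h0 : ¬ ∀ᵐ x ∂E.ref, E.h x = 0) (hη : η ∈ E.natSpace) (v : EuclideanSpace ℝ (Fin d)) :
    0 ∈ interior (integrableExpSet (fun x => ⟪v, E.T x⟫) (E.law η)) := by
  rw [mem_interior_iff_mem_nhds]
  have hc : Continuous fun t : ℝ => η + t • v := by fun_prop
  have := hc.continuousAt.preimage_mem_nhds (x := 0)
    (t := E.natSpace) (hE.isOpen_natSpace.mem_nhds (by simpa using hη))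
  exact mem_of_superset this fun t ht => (integrable_exp_mul_inner h0 v ht).1

lemma Regular.memLp_T (hE : E.Regular) (h0 : ¬ ∀ᵐ x ∂E.ref, E.h x = 0) (hη : η ∈ E.natSpace) :
    MemLp E.T 2 (E.law η) := by
  rw [memLp_piLp_iff]
  intro l
  have := memLp_of_mem_interior_integrableExpSet
    (hE.zero_mem_interior_integrableExpSet h0 hη (EuclideanSpace.single l 1)) 2
  simpa [EuclideanSpace.inner_single_left] using this

lemma Regular.integrable_T (hE : E.Regular) (h0 : ¬ ∀ᵐ x ∂E.ref, E.h x = 0)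
    (hη : η ∈ E.natSpace) : Integrable E.T (E.law η) := by
  have := isProbabilityMeasure_law h0 hη
  exact (hE.memLp_T h0 hη).integrable (by norm_num)

lemma Regular.inner_meanParam (hE : E.Regular) (h0 : ¬ ∀ᵐ x ∂E.ref, E.h x = 0)
    (hη : η ∈ E.natSpace) (v : EuclideanSpace ℝ (Fin d)) :
    ⟪v, E.meanParam η⟫ = ∫ x, ⟪v, E.T x⟫ ∂E.law η :=
  (integral_inner (hE.integrable_T h0 hη) v).symm

lemma Regular.relEnt_eq (hE : E.Regular) (h0 : ¬ ∀ᵐ x ∂E.ref, E.h x = 0) (hη : η ∈ E.natSpace)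
    (hη' : η' ∈ E.natSpace) :
    E.relEnt η η' = ⟪η - η', E.meanParam η⟫ - (E.logPartition η - E.logPartition η') := by
  have := isProbabilityMeasure_law h0 hη
  have := isProbabilityMeasure_law h0 hη'
  have hT := E.measurable_T
  have hr : (E.law η).rnDeriv (E.law η') =ᵐ[E.law η] fun x => ENNReal.ofReal
      (Real.exp (⟪η - η', E.T x⟫ - (E.logPartition η - E.logPartition η'))) := by
    refine (law_absolutelyContinuous η η').ae_le ?_
    have := Measure.rnDeriv_withDensity (E.law η') (f := fun x => ENNReal.ofReal
      (Real.exp (⟪η - η', E.T x⟫ - (E.logPartition η - E.logPartition η')))) (by fun_prop)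
    rwa [← law_eq_withDensity η η'] at this
  rw [relEnt, InformationTheory.toReal_klDiv_of_measure_eq (law_absolutelyContinuous η η')
    (by simp), hE.inner_meanParam h0 hη]
  have e : llr (E.law η) (E.law η') =ᵐ[E.law η] fun x =>
      ⟪η - η', E.T x⟫ - (E.logPartition η - E.logPartition η') := by
    filter_upwards [hr] with x hx
    rw [llr, hx, ENNReal.toReal_ofReal (Real.exp_pos _).le, Real.log_exp]
  rw [integral_congr_ae e, integral_sub ((hE.integrable_T h0 hη).const_inner _)
    (integrable_const _)]
  simp

lemma relEnt_nonneg (η η' : EuclideanSpace ℝ (Fin d)) : 0 ≤ E.relEnt η η' :=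
  ENNReal.toReal_nonneg

/-! ### Conjugate duality -/

lemma inner_sub_logPartition_le_conj (hη : η ∈ E.natSpace) (hκ : κ ∈ E.conjDomain) :
    ⟪η, κ⟫ - E.logPartition η ≤ E.conj κ :=
  le_ciSup (f := fun η : E.natSpace =>
    ⟪(η : EuclideanSpace ℝ (Fin d)), κ⟫ - E.logPartition η) hκ ⟨η, hη⟩

/-- Gibbs' inequality says that `η` attains the supremum defining the conjugate at `κ(η)`. -/
lemma Regular.conj_meanParam (hE : E.Regular) (h0 : ¬ ∀ᵐ x ∂E.ref, E.h x = 0)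
    (hη : η ∈ E.natSpace) :
    E.conj (E.meanParam η) = ⟪η, E.meanParam η⟫ - E.logPartition η := by
  refine le_antisymm ?_ (inner_sub_logPartition_le_conj hη
    (interior_subset (hE.meanParam_mem η hη)))
  have : Nonempty E.natSpace := ⟨⟨η, hη⟩⟩
  refine ciSup_le fun θ => ?_
  have h := hE.relEnt_eq h0 hη θ.2
  have := relEnt_nonneg (E := E) η θ
  rw [h, inner_sub_left] at this
  linarith

lemma Regular.relEnt_eq_conj (hE : E.Regular) (h0 : ¬ ∀ᵐ x ∂E.ref, E.h x = 0)
    (hη : η ∈ E.natSpace) (hη' : η' ∈ E.natSpace) :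
    E.relEnt η η' = E.conj (E.meanParam η) - (⟪η', E.meanParam η⟫ - E.logPartition η') := by
  rw [hE.relEnt_eq h0 hη hη', hE.conj_meanParam h0 hη, inner_sub_left]; ring

/-- A maximiser in the definition of the conjugate is a subgradient, hence the gradient. -/
lemma natParam_eq_of_conj_eq (hη : η ∈ E.natSpace) (hκ : κ ∈ interior E.conjDomain)
    (hd : DifferentiableAt ℝ E.conj κ) (h : E.conj κ = ⟪η, κ⟫ - E.logPartition η) :
    E.natParam κ = η := by
  have hmin : IsLocalMin (fun y => E.conj y - ⟪η, y⟫) κ := by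
    filter_upwards [mem_interior_iff_mem_nhds.1 hκ] with y hy
    have := inner_sub_logPartition_le_conj hη hy
    linarith
  have hg := hd.hasGradientAt.hasFDerivAt
  have h2 : HasFDerivAt (fun y : EuclideanSpace ℝ (Fin d) => ⟪η, y⟫) (innerSL ℝ η) κ :=
    (innerSL ℝ η).hasFDerivAt
  have h3 := hmin.hasFDerivAt_eq_zero (hg.sub h2)
  refine ext_inner_right ℝ fun v => ?_
  have := DFunLike.congr_fun h3 v
  rw [natParam, ← InnerProductSpace.toDual_apply_apply (𝕜 := ℝ)]
  simpa [sub_eq_zero] using this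

lemma Regular.natParam_meanParam (hE : E.Regular) (h0 : ¬ ∀ᵐ x ∂E.ref, E.h x = 0)
    (hη : η ∈ E.natSpace) : E.natParam (E.meanParam η) = η :=
  natParam_eq_of_conj_eq hη (hE.meanParam_mem η hη)
    ((hE.contDiffAt_conj η hη).differentiableAt (by norm_num)) (hE.conj_meanParam h0 hη)

lemma Regular.inner_sub_logPartition_lt_conj (hE : E.Regular)
    (h0 : ¬ ∀ᵐ x ∂E.ref, E.h x = 0) (hη : η ∈ E.natSpace) (hη' : η' ∈ E.natSpace)
    (hne : η' ≠ η) : ⟪η', E.meanParam η⟫ - E.logPartition η' < E.conj (E.meanParam η) := by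
  refine lt_of_le_of_ne (inner_sub_logPartition_le_conj hη'
    (interior_subset (hE.meanParam_mem η hη))) fun h => hne ?_
  rw [← natParam_eq_of_conj_eq hη' (hE.meanParam_mem η hη)
    ((hE.contDiffAt_conj η hη).differentiableAt (by norm_num)) h.symm,
    hE.natParam_meanParam h0 hη]

/-- A local maximiser of `η ↦ ⟪η, κ⟫ - A η` has mean parameter `κ`. -/
lemma Regular.meanParam_eq_of_isLocalMax (hE : E.Regular) (h0 : ¬ ∀ᵐ x ∂E.ref, E.h x = 0)
    (hη : η ∈ E.natSpace) (h : IsLocalMax (fun θ => ⟪θ, κ⟫ - E.logPartition θ) η) :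
    E.meanParam η = κ := by
  have := isProbabilityMeasure_law h0 hη
  refine ext_inner_left ℝ fun v => ?_
  have hc : ContinuousAt (fun t : ℝ => η + t • v) 0 := by fun_prop
  have hmem : ∀ᶠ t : ℝ in 𝓝 0, η + t • v ∈ E.natSpace :=
    hc.preimage_mem_nhds (hE.isOpen_natSpace.mem_nhds (by simpa using hη))
  have hmax : IsLocalMax (fun t : ℝ => t * ⟪v, κ⟫
      - cgf (fun x => ⟪v, E.T x⟫) (E.law η) t) 0 := by
    have h' : ∀ᶠ θ in 𝓝 (η + (0 : ℝ) • v),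
      ⟪θ, κ⟫ - E.logPartition θ ≤ ⟪η, κ⟫ - E.logPartition η := by
      rw [zero_smul, add_zero]; exact h
    filter_upwards [hc.eventually h', hmem] with t ht hm
    rw [(integrable_exp_mul_inner h0 v hm).2,
      (integrable_exp_mul_inner h0 v (t := 0) (by simpa using hη)).2]
    rw [inner_add_left, real_inner_smul_left] at ht
    simp only [zero_smul, add_zero, zero_mul]
    linarith
  have hi := hE.zero_mem_interior_integrableExpSet h0 hη v
  have hd : HasDerivAt (cgf (fun x => ⟪v, E.T x⟫) (E.law η)) ⟪v, E.meanParam η⟫ 0 := by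
    have := (analyticAt_cgf hi).differentiableAt.hasDerivAt
    rw [deriv_cgf_zero hi] at this
    simpa [hE.inner_meanParam h0 hη] using this
  have := hmax.hasDerivAt_eq_zero (((hasDerivAt_id (0 : ℝ)).mul_const ⟪v, κ⟫).sub hd)
  linarith

/-- For `κ` near `κ(η)` the maximum of `θ ↦ ⟪θ, κ⟫ - A θ` over a small closed ball around `η` is
attained inside, so the mean parameters fill a neighbourhood of `κ(η)`. -/
lemma Regular.image_meanParam_mem_nhds (hE : E.Regular) (h0 : ¬ ∀ᵐ x ∂E.ref, E.h x = 0)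
    (hη : η ∈ E.natSpace) : E.meanParam '' E.natSpace ∈ 𝓝 (E.meanParam η) := by
  obtain ⟨r, hr, hball⟩ := Metric.nhds_basis_closedBall.mem_iff.1
    (hE.isOpen_natSpace.mem_nhds hη)
  have hA : ContinuousOn E.logPartition (Metric.closedBall η r) :=
    hE.contDiffOn_logPartition.continuousOn.mono hball
  have hcont : ∀ y, ContinuousOn (fun θ => ⟪θ, y⟫ - E.logPartition θ)
      (Metric.closedBall η r) := fun y => ContinuousOn.sub (by fun_prop) hA
  -- the gap on the sphere
  obtain ⟨δ, hδ, hgap⟩ : ∃ δ > 0, ∀ θ ∈ Metric.sphere η r,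
      ⟪θ, E.meanParam η⟫ - E.logPartition θ + δ ≤ ⟪η, E.meanParam η⟫ - E.logPartition η := by
    rcases (Metric.sphere η r).eq_empty_or_nonempty with he | hne
    · exact ⟨1, one_pos, by simp [he]⟩
    obtain ⟨θ, hθ, hmax⟩ := (isCompact_sphere η r).exists_isMaxOn hne
      ((hcont (E.meanParam η)).mono Metric.sphere_subset_closedBall)
    have hlt := hE.inner_sub_logPartition_lt_conj h0 hη
      (hball (Metric.sphere_subset_closedBall hθ)) (Metric.ne_of_mem_sphere hθ hr.ne')
    rw [hE.conj_meanParam h0 hη] at hlt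
    exact ⟨_, sub_pos.2 hlt, fun θ' hθ' => by
      have := isMaxOn_iff.1 hmax θ' hθ'
      linarith⟩
  refine mem_of_superset (Metric.ball_mem_nhds _ (div_pos hδ hr)) fun y hy => ?_
  obtain ⟨θ, hθ, hmax⟩ := (isCompact_closedBall η r).exists_isLocalMax_mem_open
    Metric.ball_subset_closedBall (hcont y) (Metric.mem_closedBall_self hr.le)
    (fun θ hθ => by
      have hs : θ ∈ Metric.sphere η r := by
        rw [← Metric.closedBall_sdiff_ball]; exact hθ
      have h1 := hgap θ hs
      have h2 : ⟪θ - η, y - E.meanParam η⟫ < δ := by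
        refine (real_inner_le_norm _ _).trans_lt ?_
        rw [mem_sphere_iff_norm.1 hs]
        rw [mem_ball_iff_norm] at hy
        calc r * ‖y - E.meanParam η‖ < r * (δ / r) := mul_lt_mul_of_pos_left hy hr
          _ = δ := mul_div_cancel₀ _ hr.ne'
      simp only [inner_sub_left, inner_sub_right] at h2
      linarith) Metric.isOpen_ball
  have hθ' := hball (Metric.ball_subset_closedBall hθ)
  exact ⟨θ, hθ', hE.meanParam_eq_of_isLocalMax h0 hθ' hmax⟩

lemma convexOn_conj (hne : E.natSpace.Nonempty) : ConvexOn ℝ E.conjDomain E.conj := by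
  have : Nonempty E.natSpace := hne.to_subtype
  have key : ∀ x ∈ E.conjDomain, ∀ y ∈ E.conjDomain, ∀ a b : ℝ, 0 ≤ a → 0 ≤ b → a + b = 1 →
      ∀ θ : E.natSpace, ⟪(θ : EuclideanSpace ℝ (Fin d)), a • x + b • y⟫ - E.logPartition θ
        ≤ a * E.conj x + b * E.conj y := by
    intro x hx y hy a b ha hb hab θ
    have h1 := mul_le_mul_of_nonneg_left (inner_sub_logPartition_le_conj θ.2 hx) ha
    have h2 := mul_le_mul_of_nonneg_left (inner_sub_logPartition_le_conj θ.2 hy) hb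
    rw [inner_add_right, real_inner_smul_right, real_inner_smul_right]
    have h3 : E.logPartition θ = a * E.logPartition θ + b * E.logPartition θ := by
      rw [← add_mul, hab, one_mul]
    linarith
  refine ⟨fun x hx y hy a b ha hb hab => ?_, fun x hx y hy a b ha hb hab => ?_⟩
  · exact ⟨_, Set.forall_mem_range.2 (key x hx y hy a b ha hb hab)⟩
  · exact ciSup_le (key x hx y hy a b ha hb hab)

lemma continuousAt_conj (hne : E.natSpace.Nonempty) (hκ : κ ∈ interior E.conjDomain) :
    ContinuousAt E.conj κ :=
  (convexOn_conj hne).continuousOn_interior.continuousAt (isOpen_interior.mem_nhds hκ)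

end ExpFamily

namespace ExpFamily

variable {S : Type*} [MeasurableSpace S] {d K : ℕ} {E : ExpFamily S d}
  {η η' η₁ η₂ : EuclideanSpace ℝ (Fin d)} {i : Fin K}

/-! ### The allocation problem -/

/-- The conjugate is strictly convex between two mean parameters. Close to `κ(η)` the conjugate is
attained at some `θ`, which cannot be optimal both at `κ(η)` and at `κ(η')`. -/
lemma Regular.conj_lt_of_ne (hE : E.Regular) (h0 : ¬ ∀ᵐ x ∂E.ref, E.h x = 0)
    (hη : η ∈ E.natSpace) (hη' : η' ∈ E.natSpace) (hne : η ≠ η') {a b : ℝ} (ha : 0 < a)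
    (hb : 0 < b) (hab : a + b = 1) :
    E.conj (a • E.meanParam η + b • E.meanParam η')
      < a * E.conj (E.meanParam η) + b * E.conj (E.meanParam η') := by
  set x := E.meanParam η
  set y := E.meanParam η'
  have hx : x ∈ E.conjDomain := interior_subset (hE.meanParam_mem η hη)
  have hy : y ∈ E.conjDomain := interior_subset (hE.meanParam_mem η' hη')
  have hconv := convexOn_conj (E := E) ⟨η, hη⟩
  -- a point of the segment close to `x`, and closer to it than the given point
  obtain ⟨t, ht, ht0, htb⟩ : ∃ t : ℝ, (1 - t) • x + t • y ∈ E.meanParam '' E.natSpace ∧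
      0 < t ∧ t < b := by
    have hc : Tendsto (fun t : ℝ => (1 - t) • x + t • y) (𝓝[>] 0) (𝓝 x) := by
      have : Continuous fun t : ℝ => (1 - t) • x + t • y := by fun_prop
      simpa using (this.tendsto 0).mono_left nhdsWithin_le_nhds
    obtain ⟨t, h1, h2⟩ := ((hc.eventually (hE.image_meanParam_mem_nhds h0 hη)).and
      (Ioo_mem_nhdsGT hb)).exists
    exact ⟨t, h1, h2.1, h2.2⟩
  have hlt : E.conj ((1 - t) • x + t • y) < (1 - t) * E.conj x + t * E.conj y := by
    obtain ⟨θ, hθ, hθe⟩ := ht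
    have h1 := hE.conj_meanParam h0 hθ
    rw [hθe, inner_add_right, real_inner_smul_right, real_inner_smul_right] at h1
    have h2 := inner_sub_logPartition_le_conj hθ hx
    have h3 := inner_sub_logPartition_le_conj hθ hy
    rw [h1]
    rcases eq_or_ne θ η with rfl | hθη
    · have h4 := hE.inner_sub_logPartition_lt_conj h0 hη' hθ hne
      nlinarith
    · have h4 := hE.inner_sub_logPartition_lt_conj h0 hη hθ hθη
      nlinarith
  have h1t : 0 < 1 - t := by linarith
  have hz : (1 - t) • x + t • y ∈ E.conjDomain :=
    hconv.1 hx hy h1t.le ht0.le (by ring)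
  set s := a / (1 - t) with hs
  have hs0 : 0 < s := div_pos ha h1t
  have hs1 : s ≤ 1 := (div_le_one h1t).2 (by linarith)
  have hst : s * (1 - t) = a := div_mul_cancel₀ _ h1t.ne'
  have e : a • x + b • y = s • ((1 - t) • x + t • y) + (1 - s) • y := by
    rw [smul_add, smul_smul, smul_smul, hst, add_assoc, ← add_smul]
    congr 2
    linarith
  have h5 := hconv.2 hz hy hs0.le (sub_nonneg.2 hs1) (by ring)
  rw [← e, smul_eq_mul, smul_eq_mul] at h5
  have h6 := mul_lt_mul_of_pos_left hlt hs0
  have h7 : s * ((1 - t) * E.conj x + t * E.conj y) + (1 - s) * E.conj y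
      = a * E.conj x + b * E.conj y := by
    have : b = 1 - s * (1 - t) := by linarith
    rw [this, ← hst]; ring
  linarith

/-- The mean parameters of the arms when arm `i` has mean `x` and all others have mean `y`. -/
def armMean (i : Fin K) (x y : EuclideanSpace ℝ (Fin d)) (l : Fin K) :
    EuclideanSpace ℝ (Fin d) := if l = i then x else y

/-- The mean of all arms but `j` when arm `l` has frequency `w l` and mean `x l`; it is `0` if
`w j = 1`. -/
noncomputable def mixMean (w : Fin K → ℝ) (x : Fin K → EuclideanSpace ℝ (Fin d)) (j : Fin K) :
    EuclideanSpace ℝ (Fin d) := (1 - w j)⁻¹ • ∑ l ∈ univ.erase j, w l • x l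

variable (E) in
/-- The maximal log-likelihood per observation (without the factors `h`) under the hypothesis that
`j` is the odd arm, when arm `l` has frequency `w l` and empirical mean `x l`. -/
noncomputable def profile (w : Fin K → ℝ) (x : Fin K → EuclideanSpace ℝ (Fin d)) (j : Fin K) : ℝ :=
  w j * E.conj (x j) + (1 - w j) * E.conj (mixMean w x j)

lemma sum_erase_eq {w : Fin K → ℝ} (hw : w ∈ stdSimplex ℝ (Fin K)) (j : Fin K) :
    ∑ l ∈ univ.erase j, w l = 1 - w j := by
  rw [← hw.2, ← Finset.add_sum_erase univ w (mem_univ j)]; ring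

lemma sum_erase_erase_eq {w : Fin K → ℝ} (hw : w ∈ stdSimplex ℝ (Fin K)) {j : Fin K}
    (hj : j ≠ i) : ∑ l ∈ (univ.erase j).erase i, w l = 1 - w i - w j := by
  have := Finset.add_sum_erase (univ.erase j) w (mem_erase.2 ⟨hj.symm, mem_univ i⟩)
  rw [sum_erase_eq hw] at this
  linarith

lemma exists_ne_of_three_le (hK : 3 ≤ K) (i j : Fin K) : ∃ l : Fin K, l ≠ i ∧ l ≠ j := by
  have h : ((univ.erase i).erase j).Nonempty := by
    rw [← card_pos]
    have h1 := pred_card_le_card_erase (s := univ.erase i) (a := j)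
    have h2 := pred_card_le_card_erase (s := (univ : Finset (Fin K))) (a := i)
    rw [card_univ, Fintype.card_fin] at h2
    omega
  obtain ⟨l, hl⟩ := h
  simp only [mem_erase, mem_univ, and_true] at hl
  exact ⟨l, hl.2, hl.1⟩

lemma lt_one_of_pos (hK : 3 ≤ K) {w : Fin K → ℝ} (hw : w ∈ stdSimplex ℝ (Fin K))
    (hpos : ∀ l, 0 < w l) (j : Fin K) : w j < 1 := by
  obtain ⟨l, hl, -⟩ := exists_ne_of_three_le hK j j
  have := single_le_sum (f := w) (fun l _ => hw.1 l) (mem_erase.2 ⟨hl, mem_univ l⟩)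
  rw [sum_erase_eq hw] at this
  linarith [hpos l]

lemma mixMean_mem_convexHull {w : Fin K → ℝ} (hw : w ∈ stdSimplex ℝ (Fin K)) {j : Fin K}
    (hj : w j < 1) (x : Fin K → EuclideanSpace ℝ (Fin d)) :
    mixMean w x j ∈ convexHull ℝ (Set.range x) := by
  have h := Finset.centerMass_mem_convexHull (univ.erase j) (w := w) (z := x) (s := Set.range x)
    (fun l _ => hw.1 l) (by rw [sum_erase_eq hw]; linarith) (fun l _ => ⟨l, rfl⟩)
  rwa [Finset.centerMass, sum_erase_eq hw] at h

lemma norm_mixMean_sub_le {w : Fin K → ℝ} (hw : w ∈ stdSimplex ℝ (Fin K)) {j : Fin K}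
    (hj : w j < 1) (x y : Fin K → EuclideanSpace ℝ (Fin d)) :
    ‖mixMean w x j - mixMean w y j‖ ≤ ∑ l, ‖x l - y l‖ := by
  have h1 : 0 < 1 - w j := sub_pos.2 hj
  rw [mixMean, mixMean, ← smul_sub, ← sum_sub_distrib, norm_smul, norm_inv,
    Real.norm_of_nonneg h1.le, inv_mul_le_iff₀ h1]
  refine (norm_sum_le _ _).trans ?_
  rw [mul_sum]
  refine (sum_le_sum fun l hl => ?_).trans
    (sum_le_sum_of_subset_of_nonneg (erase_subset j univ) fun l _ _ => by positivity)
  rw [← smul_sub, norm_smul, Real.norm_of_nonneg (hw.1 l)]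
  refine mul_le_mul_of_nonneg_right ?_ (norm_nonneg _)
  rw [← sum_erase_eq hw]
  exact single_le_sum (f := w) (fun l _ => hw.1 l) hl

/-- The profile depends continuously on the means of the arms, uniformly in the frequencies. -/
lemma tendsto_profile_sub (hne : E.natSpace.Nonempty) {x : Fin K → EuclideanSpace ℝ (Fin d)}
    (hx : ∀ l, x l ∈ interior E.conjDomain) {u : ℕ → Fin K → EuclideanSpace ℝ (Fin d)}
    (hu : ∀ l, Tendsto (fun n => u n l) atTop (𝓝 (x l))) {w : ℕ → Fin K → ℝ} {j : Fin K}
    (hw : ∀ᶠ n in atTop, w n ∈ stdSimplex ℝ (Fin K) ∧ w n j < 1) :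
    Tendsto (fun n => E.profile (w n) (u n) j - E.profile (w n) x j) atTop (𝓝 0) := by
  have h1 : Tendsto (fun n => E.conj (u n j) - E.conj (x j)) atTop (𝓝 0) := by
    simpa using ((continuousAt_conj hne (hx j)).tendsto.comp (hu j)).sub_const (E.conj (x j))
  have hsum : Tendsto (fun n => ∑ l, ‖u n l - x l‖) atTop (𝓝 0) := by
    have : Tendsto (fun n => ∑ l, ‖u n l - x l‖) atTop (𝓝 (∑ l : Fin K, (0 : ℝ))) :=
      tendsto_finsetSum _ fun l _ => by simpa using ((hu l).sub_const (x l)).norm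
    simpa using this
  have h2 : Tendsto (fun n => E.conj (mixMean (w n) (u n) j) - E.conj (mixMean (w n) x j))
      atTop (𝓝 0) := by
    have hC : IsCompact (convexHull ℝ (Set.range x)) :=
      (Set.finite_range x).isCompact_convexHull (𝕜 := ℝ)
    have hCM : convexHull ℝ (Set.range x) ⊆ interior E.conjDomain :=
      convexHull_min (Set.range_subset_iff.2 hx) (convexOn_conj hne).1.interior
    rw [Metric.tendsto_atTop']
    intro ε hε
    obtain ⟨δ, hδ, hδε⟩ := Metric.mem_uniformity_dist.1
      (hC.uniformContinuousAt_of_continuousAt E.conj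
        (fun a ha => continuousAt_conj hne (hCM ha)) (Metric.dist_mem_uniformity hε))
    obtain ⟨N, hN⟩ := eventually_atTop.1 (hw.and (hsum.eventually (gt_mem_nhds hδ)))
    refine ⟨N, fun n hn => ?_⟩
    obtain ⟨⟨hn1, hn2⟩, hn3⟩ := hN n hn.le
    have h3 : dist (mixMean (w n) x j) (mixMean (w n) (u n) j) < δ := by
      rw [dist_comm, dist_eq_norm]
      exact (norm_mixMean_sub_le hn1 hn2 _ _).trans_lt hn3
    have h4 := hδε h3 (mixMean_mem_convexHull hn1 hn2 x)
    rw [dist_zero_right, ← dist_eq_norm, dist_comm]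
    exact h4
  have h3 := (h1.norm).add h2.norm
  rw [norm_zero, add_zero] at h3
  refine squeeze_zero_norm' ?_ h3
  filter_upwards [hw] with n hn
  have h0 := hn.1.1 j
  have e : E.profile (w n) (u n) j - E.profile (w n) x j
      = w n j * (E.conj (u n j) - E.conj (x j))
        + (1 - w n j) * (E.conj (mixMean (w n) (u n) j) - E.conj (mixMean (w n) x j)) := by
    simp only [profile]; ring
  rw [e]
  refine (norm_add_le _ _).trans (add_le_add ?_ ?_)
  · rw [norm_mul, Real.norm_of_nonneg h0]
    exact mul_le_of_le_one_left (norm_nonneg _) hn.2.le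
  · rw [norm_mul, Real.norm_of_nonneg (by linarith [hn.2])]
    exact mul_le_of_le_one_left (norm_nonneg _) (by linarith)

lemma mixMean_armMean_self {w : Fin K → ℝ} (hw : w ∈ stdSimplex ℝ (Fin K)) (hi : w i < 1)
    (x y : EuclideanSpace ℝ (Fin d)) : mixMean w (armMean i x y) i = y := by
  have h : ∑ l ∈ univ.erase i, w l • armMean i x y l = (1 - w i) • y := by
    rw [← sum_erase_eq hw, sum_smul]
    exact sum_congr rfl fun l hl => by simp [armMean, (mem_erase.1 hl).1]
  rw [mixMean, h, inv_smul_smul₀ (by linarith)]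

lemma smul_mixMean_armMean {w : Fin K → ℝ} (hw : w ∈ stdSimplex ℝ (Fin K)) {j : Fin K}
    (hj : j ≠ i) (x y : EuclideanSpace ℝ (Fin d)) :
    mixMean w (armMean i x y) j
      = (w i / (1 - w j)) • x + ((1 - w i - w j) / (1 - w j)) • y := by
  have h : ∑ l ∈ univ.erase j, w l • armMean i x y l = w i • x + (1 - w i - w j) • y := by
    rw [← Finset.add_sum_erase _ _ (mem_erase.2 ⟨hj.symm, mem_univ i⟩), ← sum_erase_erase_eq hw hj,
      sum_smul]
    congr 1
    · simp [armMean]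
    · exact sum_congr rfl fun l hl => by simp [armMean, (mem_erase.1 hl).1]
  rw [mixMean, h, smul_add, smul_smul, smul_smul, div_eq_inv_mul, div_eq_inv_mul]

lemma one_sub_sub_nonneg {w : Fin K → ℝ} (hw : w ∈ stdSimplex ℝ (Fin K)) {j : Fin K}
    (hj : j ≠ i) : 0 ≤ 1 - w i - w j := by
  rw [← sum_erase_erase_eq hw hj]
  exact sum_nonneg fun l _ => hw.1 l

lemma alternative_nonneg {w : Fin K → ℝ} (hw : w ∈ stdSimplex ℝ (Fin K))
    (p : {j : Fin K // j ≠ i} × E.natSpace × E.natSpace) :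
    0 ≤ w i * E.relEnt η₁ p.2.2 + w p.1 * E.relEnt η₂ p.2.1
      + (1 - w i - w p.1) * E.relEnt η₂ p.2.2 := by
  have h1 := mul_nonneg (hw.1 i) (relEnt_nonneg (E := E) η₁ p.2.2)
  have h2 := mul_nonneg (hw.1 p.1) (relEnt_nonneg (E := E) η₂ p.2.1)
  have h3 := mul_nonneg (one_sub_sub_nonneg hw p.1.2) (relEnt_nonneg (E := E) η₂ p.2.2)
  linarith

lemma bddBelow_alternatives {w : Fin K → ℝ} (hw : w ∈ stdSimplex ℝ (Fin K)) :
    BddBelow (Set.range fun p : {j : Fin K // j ≠ i} × E.natSpace × E.natSpace =>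
      w i * E.relEnt η₁ p.2.2 + w p.1 * E.relEnt η₂ p.2.1
        + (1 - w i - w p.1) * E.relEnt η₂ p.2.2) :=
  ⟨0, Set.forall_mem_range.2 fun p => alternative_nonneg hw p⟩

lemma allocValue_le {w : Fin K → ℝ} (hw : w ∈ stdSimplex ℝ (Fin K))
    (p : {j : Fin K // j ≠ i} × E.natSpace × E.natSpace) :
    E.allocValue i η₁ η₂ w ≤ w i * E.relEnt η₁ p.2.2 + w p.1 * E.relEnt η₂ p.2.1
      + (1 - w i - w p.1) * E.relEnt η₂ p.2.2 :=
  ciInf_le (bddBelow_alternatives hw) p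

lemma nonempty_alternatives (hK : 3 ≤ K) (hne : E.natSpace.Nonempty) :
    Nonempty ({j : Fin K // j ≠ i} × E.natSpace × E.natSpace) := by
  obtain ⟨j, hj, -⟩ := exists_ne_of_three_le hK i i
  obtain ⟨θ, hθ⟩ := hne
  exact ⟨⟨j, hj⟩, ⟨θ, hθ⟩, ⟨θ, hθ⟩⟩

lemma concaveOn_allocValue (hK : 3 ≤ K) (hne : E.natSpace.Nonempty) :
    ConcaveOn ℝ (stdSimplex ℝ (Fin K)) (E.allocValue i η₁ η₂) := by
  have := nonempty_alternatives (i := i) hK hne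
  refine ⟨convex_stdSimplex ℝ _, fun x hx y hy a b ha hb hab => le_ciInf fun p => ?_⟩
  have h1 := mul_le_mul_of_nonneg_left (allocValue_le (η₁ := η₁) (η₂ := η₂) hx p) ha
  have h2 := mul_le_mul_of_nonneg_left (allocValue_le (η₁ := η₁) (η₂ := η₂) hy p) hb
  simp only [Pi.add_apply, Pi.smul_apply, smul_eq_mul]
  have e : (1 : ℝ) = a + b := hab.symm
  have e1 : 1 - (a * x i + b * y i) - (a * x p.1 + b * y p.1)
      = a * (1 - x i - x p.1) + b * (1 - y i - y p.1) := by rw [mul_sub, mul_sub]; linarith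
  rw [e1]
  nlinarith

/-- The value of an allocation is monotone and homogeneous in the sampling frequencies. -/
lemma mul_allocValue_le (hK : 3 ≤ K) (hne : E.natSpace.Nonempty) {w w' : Fin K → ℝ}
    (hw : w ∈ stdSimplex ℝ (Fin K)) (hw' : w' ∈ stdSimplex ℝ (Fin K)) {t : ℝ} (ht : 0 ≤ t)
    (h : ∀ l, t * w' l ≤ w l) :
    t * E.allocValue i η₁ η₂ w' ≤ E.allocValue i η₁ η₂ w := by
  have := nonempty_alternatives (i := i) hK hne
  refine le_ciInf fun p => ?_
  refine (mul_le_mul_of_nonneg_left (allocValue_le hw' p) ht).trans ?_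
  have h1 : t * (1 - w' i - w' p.1) ≤ 1 - w i - w p.1 := by
    rw [← sum_erase_erase_eq hw p.1.2, ← sum_erase_erase_eq hw' p.1.2, mul_sum]
    exact sum_le_sum fun l _ => h l
  have h2 := mul_le_mul_of_nonneg_right (h i) (relEnt_nonneg (E := E) η₁ p.2.2)
  have h3 := mul_le_mul_of_nonneg_right (h p.1) (relEnt_nonneg (E := E) η₂ p.2.1)
  have h4 := mul_le_mul_of_nonneg_right h1 (relEnt_nonneg (E := E) η₂ p.2.2)
  linarith

/-- The value of an allocation is the least difference between the profile of the true hypothesis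
and that of an alternative. The alternatives are optimised one by one: `η'₁ = η₂` is best, and the
infimum over `η'₂` is a conjugate at the mixed mean. -/
lemma Regular.le_allocValue_iff (hE : E.Regular) (h0 : ¬ ∀ᵐ x ∂E.ref, E.h x = 0) (hK : 3 ≤ K)
    (hη₁ : η₁ ∈ E.natSpace) (hη₂ : η₂ ∈ E.natSpace) {w : Fin K → ℝ}
    (hw : w ∈ stdSimplex ℝ (Fin K)) (hpos : ∀ l, 0 < w l) {c : ℝ} :
    c ≤ E.allocValue i η₁ η₂ w ↔ ∀ j, j ≠ i →
      c ≤ E.profile w (armMean i (E.meanParam η₁) (E.meanParam η₂)) i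
        - E.profile w (armMean i (E.meanParam η₁) (E.meanParam η₂)) j := by
  have := nonempty_alternatives (i := i) hK ⟨η₁, hη₁⟩
  have hNe : Nonempty E.natSpace := ⟨⟨η₁, hη₁⟩⟩
  set x := E.meanParam η₁
  set y := E.meanParam η₂
  have hlt := lt_one_of_pos hK hw hpos
  -- the value at an alternative, in terms of the mixed mean
  have key : ∀ j, j ≠ i → ∀ θ ∈ E.natSpace, w i * E.relEnt η₁ θ + (1 - w i - w j) * E.relEnt η₂ θ
      = w i * E.conj x + (1 - w i - w j) * E.conj y
        - (1 - w j) * (⟪θ, mixMean w (armMean i x y) j⟫ - E.logPartition θ) := by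
    intro j hj θ hθ
    have h1 : (1 - w j) ≠ 0 := by linarith [hlt j]
    rw [hE.relEnt_eq_conj h0 hη₁ hθ, hE.relEnt_eq_conj h0 hη₂ hθ,
      smul_mixMean_armMean hw hj, inner_add_right, real_inner_smul_right,
      real_inner_smul_right]
    field_simp
    ring
  have hgap : ∀ j, j ≠ i → E.profile w (armMean i x y) i - E.profile w (armMean i x y) j
      = w i * E.conj x + (1 - w i - w j) * E.conj y
        - (1 - w j) * E.conj (mixMean w (armMean i x y) j) := by
    intro j hj
    have h1 : armMean i x y i = x := by simp [armMean]
    have h2 : armMean i x y j = y := by simp [armMean, hj]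
    rw [profile, profile, mixMean_armMean_self hw (hlt i), h1, h2]
    ring
  have hmem : ∀ j, mixMean w (armMean i x y) j ∈ E.conjDomain := by
    intro j
    refine convexHull_min (Set.range_subset_iff.2 fun l => ?_) (convexOn_conj ⟨η₁, hη₁⟩).1
      (mixMean_mem_convexHull hw (hlt j) (armMean i x y))
    unfold armMean
    split_ifs
    · exact interior_subset (hE.meanParam_mem η₁ hη₁)
    · exact interior_subset (hE.meanParam_mem η₂ hη₂)
  have hself : E.relEnt η₂ η₂ = 0 := by
    rw [hE.relEnt_eq h0 hη₂ hη₂]; simp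
  rw [allocValue, le_ciInf_iff (bddBelow_alternatives hw)]
  constructor
  · intro h j hj
    rw [hgap j hj]
    have h1 : 0 < 1 - w j := by linarith [hlt j]
    have h2 : E.conj (mixMean w (armMean i x y) j)
        ≤ (w i * E.conj x + (1 - w i - w j) * E.conj y - c) / (1 - w j) := by
      refine ciSup_le fun θ => ?_
      have h3 := h (⟨j, hj⟩, ⟨η₂, hη₂⟩, θ)
      have h4 := key j hj θ θ.2
      simp only [hself] at h3
      rw [le_div_iff₀ h1]
      linarith
    rw [le_div_iff₀ h1] at h2
    linarith
  · intro h p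
    have h1 := h p.1 p.1.2
    rw [hgap p.1 p.1.2] at h1
    have h2 := key p.1 p.1.2 p.2.2 p.2.2.2
    have h3 := mul_nonneg (hw.1 p.1) (relEnt_nonneg (E := E) η₂ p.2.1)
    have h4 := mul_le_mul_of_nonneg_left (inner_sub_logPartition_le_conj p.2.2.2 (hmem p.1))
      (by linarith [hlt p.1] : 0 ≤ 1 - w p.1)
    linarith

lemma Regular.profile_lt (hE : E.Regular) (h0 : ¬ ∀ᵐ x ∂E.ref, E.h x = 0) (hK : 3 ≤ K)
    (hη₁ : η₁ ∈ E.natSpace) (hη₂ : η₂ ∈ E.natSpace) (hne : η₁ ≠ η₂) {w : Fin K → ℝ}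
    (hw : w ∈ stdSimplex ℝ (Fin K)) (hpos : ∀ l, 0 < w l) {j : Fin K} (hj : j ≠ i) :
    E.profile w (armMean i (E.meanParam η₁) (E.meanParam η₂)) j
      < E.profile w (armMean i (E.meanParam η₁) (E.meanParam η₂)) i := by
  have hlt := lt_one_of_pos hK hw hpos
  have h1 : 0 < 1 - w j := by linarith [hlt j]
  -- a third arm makes the weight of `η₂` in the mixture positive
  have hb : 0 < 1 - w i - w j := by
    obtain ⟨l, hl, hl'⟩ := exists_ne_of_three_le hK i j
    rw [← sum_erase_erase_eq hw hj]
    exact sum_pos (fun l _ => hpos l) ⟨l, by simp [hl, hl']⟩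
  have h := hE.conj_lt_of_ne h0 hη₁ hη₂ hne (div_pos (hpos i) h1) (div_pos hb h1)
    (by field_simp; ring)
  rw [← smul_mixMean_armMean hw hj] at h
  have h2 := mul_lt_mul_of_pos_left h h1
  have e : (1 - w j) * (w i / (1 - w j) * E.conj (E.meanParam η₁)
      + (1 - w i - w j) / (1 - w j) * E.conj (E.meanParam η₂))
      = w i * E.conj (E.meanParam η₁) + (1 - w i - w j) * E.conj (E.meanParam η₂) := by
    field_simp
  rw [e] at h2
  have e1 : armMean i (E.meanParam η₁) (E.meanParam η₂) i = E.meanParam η₁ := by simp [armMean]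
  have e2 : armMean i (E.meanParam η₁) (E.meanParam η₂) j = E.meanParam η₂ := by
    simp [armMean, hj]
  rw [profile, profile, mixMean_armMean_self hw (hlt i), e1, e2]
  linarith

lemma Regular.allocValue_pos (hE : E.Regular) (h0 : ¬ ∀ᵐ x ∂E.ref, E.h x = 0) (hK : 3 ≤ K)
    (hη₁ : η₁ ∈ E.natSpace) (hη₂ : η₂ ∈ E.natSpace) (hne : η₁ ≠ η₂) {w : Fin K → ℝ}
    (hw : w ∈ stdSimplex ℝ (Fin K)) (hpos : ∀ l, 0 < w l) : 0 < E.allocValue i η₁ η₂ w := by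
  set g : Fin K → ℝ := fun j =>
    E.profile w (armMean i (E.meanParam η₁) (E.meanParam η₂)) i
      - E.profile w (armMean i (E.meanParam η₁) (E.meanParam η₂)) j
  obtain ⟨l, hl, -⟩ := exists_ne_of_three_le hK i i
  obtain ⟨j, hj, hmin⟩ := exists_min_image (univ.erase i) g ⟨l, mem_erase.2 ⟨hl, mem_univ l⟩⟩
  have hj0 : 0 < g j :=
    sub_pos.2 (hE.profile_lt h0 hK hη₁ hη₂ hne hw hpos (mem_erase.1 hj).1)
  exact hj0.trans_le ((hE.le_allocValue_iff h0 hK hη₁ hη₂ hw hpos).2 fun k hk =>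
    hmin k (mem_erase.2 ⟨hk, mem_univ k⟩))

lemma allocValue_le_Dstar (hK : 3 ≤ K) (hne : E.natSpace.Nonempty) {w : Fin K → ℝ}
    (hw : w ∈ stdSimplex ℝ (Fin K)) : E.allocValue i η₁ η₂ w ≤ E.Dstar i η₁ η₂ := by
  obtain ⟨p⟩ := nonempty_alternatives (i := i) hK hne
  refine le_ciSup (f := fun w : stdSimplex ℝ (Fin K) => E.allocValue i η₁ η₂ w)
    ⟨E.relEnt η₁ p.2.2 + E.relEnt η₂ p.2.1 + E.relEnt η₂ p.2.2,
      Set.forall_mem_range.2 fun v => ?_⟩ ⟨w, hw⟩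
  refine (allocValue_le v.2 p).trans ?_
  have hle : ∀ l, v.1 l ≤ 1 := fun l => by
    have := sum_erase_eq v.2 l
    have h2 := sum_nonneg (s := univ.erase l) fun k _ => v.2.1 k
    linarith
  have h1 := mul_le_of_le_one_left (relEnt_nonneg (E := E) η₁ p.2.2) (hle i)
  have h2 := mul_le_of_le_one_left (relEnt_nonneg (E := E) η₂ p.2.1) (hle p.1)
  have h3 := mul_le_of_le_one_left (relEnt_nonneg (E := E) η₂ p.2.2)
    (by linarith [v.2.1 i, v.2.1 p.1] : 1 - v.1 i - v.1 p.1 ≤ 1)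
  exact add_le_add (add_le_add h1 h2) h3

lemma uniform_mem_stdSimplex (hK : 3 ≤ K) : (fun _ => (K : ℝ)⁻¹) ∈ stdSimplex ℝ (Fin K) := by
  have : (K : ℝ) ≠ 0 := by positivity
  exact ⟨fun _ => by positivity, by simp [this]⟩

/-- The supremum `D*` is approached by allocations that sample every arm. -/
lemma exists_pos_lt_allocValue (hK : 3 ≤ K) (hne : E.natSpace.Nonempty) {c : ℝ}
    (hc : c < E.Dstar i η₁ η₂) : ∃ w ∈ stdSimplex ℝ (Fin K), (∀ l, 0 < w l) ∧
      c < E.allocValue i η₁ η₂ w := by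
  have hu := uniform_mem_stdSimplex hK
  have : Nonempty (stdSimplex ℝ (Fin K)) := ⟨⟨_, hu⟩⟩
  obtain ⟨⟨v, hv⟩, hvc⟩ := exists_lt_of_lt_ciSup hc
  -- shrink `v` slightly towards the uniform allocation
  have ht : Tendsto (fun t : ℝ => (1 - t) * E.allocValue i η₁ η₂ v) (𝓝[>] 0)
      (𝓝 (E.allocValue i η₁ η₂ v)) := by
    have : Continuous fun t : ℝ => (1 - t) * E.allocValue i η₁ η₂ v := by fun_prop
    simpa using (this.tendsto 0).mono_left nhdsWithin_le_nhds
  obtain ⟨t, h1, h2⟩ := ((ht.eventually (lt_mem_nhds hvc)).and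
    (Ioo_mem_nhdsGT (zero_lt_one' ℝ))).exists
  have hK0 : (0 : ℝ) < (K : ℝ)⁻¹ := by positivity
  have hw := convex_stdSimplex ℝ (Fin K) hv hu (sub_nonneg.2 h2.2.le) h2.1.le (by ring)
  refine ⟨_, hw, fun l => ?_, h1.trans_le (mul_allocValue_le hK hne hw hv
    (sub_nonneg.2 h2.2.le) fun l => ?_)⟩
  · have := mul_nonneg (sub_nonneg.2 h2.2.le) (hv.1 l)
    have := mul_pos h2.1 hK0
    simp only [Pi.add_apply, Pi.smul_apply, smul_eq_mul]
    linarith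
  · have := mul_pos h2.1 hK0
    simp only [Pi.add_apply, Pi.smul_apply, smul_eq_mul]
    linarith

/-- The value of an allocation depends continuously on the mean parameters, uniformly in the
allocation. -/
lemma Regular.eventually_abs_allocValue_sub_le (hE : E.Regular)
    (h0 : ¬ ∀ᵐ x ∂E.ref, E.h x = 0) (hK : 3 ≤ K) (hη₁ : η₁ ∈ E.natSpace)
    (hη₂ : η₂ ∈ E.natSpace) {θ₁ θ₂ : ℕ → EuclideanSpace ℝ (Fin d)}
    (hθ₁ : ∀ᶠ n in atTop, θ₁ n ∈ E.natSpace) (hθ₂ : ∀ᶠ n in atTop, θ₂ n ∈ E.natSpace)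
    (h₁ : Tendsto (fun n => E.meanParam (θ₁ n)) atTop (𝓝 (E.meanParam η₁)))
    (h₂ : Tendsto (fun n => E.meanParam (θ₂ n)) atTop (𝓝 (E.meanParam η₂)))
    {w : ℕ → Fin K → ℝ}
    (hw : ∀ᶠ n in atTop, w n ∈ stdSimplex ℝ (Fin K) ∧ ∀ l, 0 < w n l) {ε : ℝ} (hε : 0 < ε) :
    ∀ᶠ n in atTop,
      |E.allocValue i (θ₁ n) (θ₂ n) (w n) - E.allocValue i η₁ η₂ (w n)| ≤ ε := by
  have hx : ∀ l, armMean i (E.meanParam η₁) (E.meanParam η₂) l ∈ interior E.conjDomain := by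
    intro l
    unfold armMean
    split_ifs
    exacts [hE.meanParam_mem η₁ hη₁, hE.meanParam_mem η₂ hη₂]
  have hu : ∀ l, Tendsto (fun n => armMean i (E.meanParam (θ₁ n)) (E.meanParam (θ₂ n)) l) atTop
      (𝓝 (armMean i (E.meanParam η₁) (E.meanParam η₂) l)) := by
    intro l
    unfold armMean
    split_ifs
    exacts [h₁, h₂]
  have hprof : ∀ᶠ n in atTop, ∀ j, ‖E.profile (w n)
      (armMean i (E.meanParam (θ₁ n)) (E.meanParam (θ₂ n))) j
      - E.profile (w n) (armMean i (E.meanParam η₁) (E.meanParam η₂)) j‖ < ε / 2 :=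
    eventually_all.2 fun j => by
      have := tendsto_profile_sub ⟨η₁, hη₁⟩ hx hu
        (hw.mono fun n hn => ⟨hn.1, lt_one_of_pos hK hn.1 hn.2 j⟩)
      exact (tendsto_zero_iff_norm_tendsto_zero.1 this).eventually (gt_mem_nhds (half_pos hε))
  filter_upwards [hprof, hθ₁, hθ₂, hw] with n hn h1 h2 hwn
  have hi := abs_lt.1 (hn i)
  have a1 := (hE.le_allocValue_iff (i := i) h0 hK h1 h2 hwn.1 hwn.2).1 le_rfl
  have a2 := (hE.le_allocValue_iff (i := i) h0 hK hη₁ hη₂ hwn.1 hwn.2).1 le_rfl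
  have b1 : E.allocValue i η₁ η₂ (w n) - ε ≤ E.allocValue i (θ₁ n) (θ₂ n) (w n) :=
    (hE.le_allocValue_iff h0 hK h1 h2 hwn.1 hwn.2).2 fun j hj => by
      have hj' := abs_lt.1 (hn j)
      linarith [a2 j hj]
  have b2 : E.allocValue i (θ₁ n) (θ₂ n) (w n) - ε ≤ E.allocValue i η₁ η₂ (w n) :=
    (hE.le_allocValue_iff h0 hK hη₁ hη₂ hwn.1 hwn.2).2 fun j hj => by
      have hj' := abs_lt.1 (hn j)
      linarith [a1 j hj]
  rw [abs_le]
  constructor <;> linarith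

/-- Allocations that are optimal for consistent estimates are asymptotically optimal. -/
lemma Regular.tendsto_allocValue_of_isOptAlloc (hE : E.Regular)
    (h0 : ¬ ∀ᵐ x ∂E.ref, E.h x = 0) (hK : 3 ≤ K) (hη₁ : η₁ ∈ E.natSpace)
    (hη₂ : η₂ ∈ E.natSpace) {θ₁ θ₂ : ℕ → EuclideanSpace ℝ (Fin d)}
    (hθ₁ : ∀ᶠ n in atTop, θ₁ n ∈ E.natSpace) (hθ₂ : ∀ᶠ n in atTop, θ₂ n ∈ E.natSpace)
    (h₁ : Tendsto (fun n => E.meanParam (θ₁ n)) atTop (𝓝 (E.meanParam η₁)))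
    (h₂ : Tendsto (fun n => E.meanParam (θ₂ n)) atTop (𝓝 (E.meanParam η₂)))
    {q : ℕ → Fin K → ℝ} (hq : ∀ᶠ n in atTop, ∀ l, 0 < q n l)
    (hopt : ∀ᶠ n in atTop, E.IsOptAlloc i (θ₁ n) (θ₂ n) (q n)) :
    Tendsto (fun n => E.allocValue i η₁ η₂ (q n)) atTop (𝓝 (E.Dstar i η₁ η₂)) := by
  have hS : E.natSpace.Nonempty := ⟨η₁, hη₁⟩
  refine tendsto_order.2 ⟨fun c hc => ?_, fun c hc => ?_⟩
  · obtain ⟨v, hv, hvpos, hvc⟩ := exists_pos_lt_allocValue hK hS hc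
    set ε := (E.allocValue i η₁ η₂ v - c) / 3
    have hε : 0 < ε := by have := sub_pos.2 hvc; positivity
    filter_upwards [hopt,
      hE.eventually_abs_allocValue_sub_le (i := i) h0 hK hη₁ hη₂ hθ₁ hθ₂ h₁ h₂
        (hopt.and hq |>.mono fun n hn => ⟨hn.1.1, hn.2⟩) hε,
      hE.eventually_abs_allocValue_sub_le (i := i) h0 hK hη₁ hη₂ hθ₁ hθ₂ h₁ h₂
        (w := fun _ => v) (Eventually.of_forall fun n => ⟨hv, hvpos⟩) hε] with n a1 a2 a3
    have a4 := isMaxOn_iff.1 a1.2 v hv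
    have a5 := abs_le.1 a2
    have a6 := abs_le.1 a3
    have e : E.allocValue i η₁ η₂ v = c + 3 * ε := by simp only [ε]; ring
    linarith
  · filter_upwards [hopt] with n hn
    exact (allocValue_le_Dstar hK hS hn.1).trans_lt hc

/-- If the sampling frequencies `w n` follow the averages of allocations `q t` whose values tend to
`D*`, then so do the values of `w n`, by concavity. -/
lemma tendsto_allocValue_of_average (hK : 3 ≤ K) (hne : E.natSpace.Nonempty)
    {q w : ℕ → Fin K → ℝ} (hq : ∀ t, q t ∈ stdSimplex ℝ (Fin K)) {c : ℝ} (hc : 0 < c)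
    (hqc : ∀ t l, c ≤ q t l)
    (hlim : Tendsto (fun t => E.allocValue i η₁ η₂ (q t)) atTop (𝓝 (E.Dstar i η₁ η₂)))
    (hw : ∀ᶠ n in atTop, w n ∈ stdSimplex ℝ (Fin K))
    (hwq : ∀ l, Tendsto (fun n : ℕ => w n l - (n : ℝ)⁻¹ * ∑ t ∈ range n, q t l) atTop (𝓝 0)) :
    Tendsto (fun n => E.allocValue i η₁ η₂ (w n)) atTop (𝓝 (E.Dstar i η₁ η₂)) := by
  have hces := hlim.cesaro
  refine tendsto_order.2 ⟨fun b hb => ?_, fun b hb => ?_⟩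
  · have hmul : Tendsto (fun t : ℝ => (1 - t) * (E.Dstar i η₁ η₂ - t)) (𝓝[>] 0)
        (𝓝 (E.Dstar i η₁ η₂)) := by
      have : Continuous fun t : ℝ => (1 - t) * (E.Dstar i η₁ η₂ - t) := by fun_prop
      simpa using (this.tendsto 0).mono_left nhdsWithin_le_nhds
    obtain ⟨t, h1, ht0, ht1⟩ := ((hmul.eventually (lt_mem_nhds hb)).and
      (Ioo_mem_nhdsGT (zero_lt_one' ℝ))).exists
    have hall : ∀ᶠ n : ℕ in atTop, ∀ l,
        ‖w n l - (n : ℝ)⁻¹ * ∑ t ∈ range n, q t l‖ < t * c :=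
      eventually_all.2 fun l => (tendsto_zero_iff_norm_tendsto_zero.1 (hwq l)).eventually
        (gt_mem_nhds (mul_pos ht0 hc))
    filter_upwards [hall, hw, eventually_gt_atTop 0,
      hces.eventually (lt_mem_nhds (sub_lt_self _ ht0))] with n hn hwn hn0 hcn
    have hn0' : (0 : ℝ) < n := by positivity
    have hsum : ∑ _t ∈ range n, (n : ℝ)⁻¹ = 1 := by
      rw [sum_const, card_range, nsmul_eq_mul, mul_inv_cancel₀ hn0'.ne']
    have hmem : ∑ t ∈ range n, (n : ℝ)⁻¹ • q t ∈ stdSimplex ℝ (Fin K) :=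
      (convex_stdSimplex ℝ (Fin K)).sum_mem (fun _ _ => by positivity) hsum fun t _ => hq t
    have happ : ∀ l, (∑ t ∈ range n, (n : ℝ)⁻¹ • q t) l = (n : ℝ)⁻¹ * ∑ t ∈ range n, q t l := by
      intro l; simp [mul_sum]
    have hJ := (concaveOn_allocValue (i := i) (η₁ := η₁) (η₂ := η₂) hK hne).le_map_sum
      (t := range n) (w := fun _ => (n : ℝ)⁻¹) (p := q) (fun _ _ => by positivity) hsum
      (fun t _ => hq t)
    simp only [smul_eq_mul, ← mul_sum] at hJ
    have hle := mul_allocValue_le (i := i) (η₁ := η₁) (η₂ := η₂) hK hne hwn hmem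
      (sub_nonneg.2 ht1.le) fun l => by
        rw [happ]
        have h2 := (abs_lt.1 (hn l)).1
        have h3 : c ≤ (n : ℝ)⁻¹ * ∑ t ∈ range n, q t l := by
          rw [le_inv_mul_iff₀ hn0']
          have := sum_le_sum (s := range n) fun t _ => hqc t l
          simpa using this
        nlinarith
    have h4 := mul_le_mul_of_nonneg_left (hcn.le.trans hJ) (sub_nonneg.2 ht1.le)
    linarith
  · filter_upwards [hw] with n hn
    exact (allocValue_le_Dstar hK hne hn).trans_lt hb

end ExpFamily

namespace ExpFamily

variable {S : Type*} [MeasurableSpace S] {d K : ℕ} {E : ExpFamily S d}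
  {η η₁ η₂ τ : EuclideanSpace ℝ (Fin d)} {n₀ : ℝ} {i j : Fin K} {a : ℕ → Fin K} {x : ℕ → S}
  {n : ℕ}

/-! ### Counts and empirical means along a trajectory -/

/-- The sampling frequencies of the arms up to time `n`, all `0` at time `0`. -/
noncomputable def freq (a : ℕ → Fin K) (n : ℕ) (l : Fin K) : ℝ := (count a n l : ℝ) / n

lemma sum_count (a : ℕ → Fin K) (n : ℕ) : ∑ l, count a n l = n := by
  have := card_eq_sum_card_fiberwise (s := Icc 1 n) (t := univ) (f := a) (by simp)
  rw [Nat.card_Icc, Nat.add_sub_cancel] at this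
  exact this.symm

lemma freq_mem_stdSimplex (a : ℕ → Fin K) (hn : 0 < n) : freq a n ∈ stdSimplex ℝ (Fin K) := by
  refine ⟨fun l => by unfold freq; positivity, ?_⟩
  unfold freq
  rw [← sum_div, ← Nat.cast_sum, sum_count, div_self (by positivity)]

lemma count_smul_oddMean (a : ℕ → Fin K) (x : ℕ → S) (n : ℕ) (j : Fin K) :
    (count a n j : ℝ) • E.oddMean a x n j = E.armSum a x n j := by
  rcases eq_or_ne (count a n j) 0 with h | h
  · have : E.armSum a x n j = 0 := by
      rw [armSum, card_eq_zero.1 h, sum_empty]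
    rw [this, h, Nat.cast_zero, zero_smul]
  · rw [oddMean, smul_inv_smul₀ (by exact_mod_cast h)]

lemma restMean_eq_mixMean (a : ℕ → Fin K) (x : ℕ → S) (hn : 0 < n) (j : Fin K) :
    E.restMean a x n j = mixMean (freq a n) (E.oddMean a x n) j := by
  have hn' : (n : ℝ) ≠ 0 := by positivity
  have h1 : E.totalSum a x n - E.armSum a x n j = ∑ l ∈ univ.erase j, E.armSum a x n l := by
    rw [totalSum, ← Finset.add_sum_erase univ _ (mem_univ j), add_sub_cancel_left]
  have h2 : ∀ l, freq a n l • E.oddMean a x n l = (n : ℝ)⁻¹ • E.armSum a x n l := fun l => by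
    rw [← count_smul_oddMean, smul_smul, freq, div_eq_inv_mul]
  rw [restMean, mixMean, h1]
  simp_rw [h2]
  rw [← smul_sum, smul_smul, freq, ← mul_inv, sub_mul, one_mul, div_mul_cancel₀ _ hn']

/-- Arm-wise laws of large numbers, from laws of large numbers for the sums over all times. -/
lemma tendsto_oddMean {j : Fin K} {κ : EuclideanSpace ℝ (Fin d)} {c : ℝ} (hc : 0 < c)
    (hfreq : ∀ᶠ n in atTop, c ≤ freq a n j)
    (h : ∀ k, Tendsto (fun n : ℕ => (n : ℝ)⁻¹ * ∑ t ∈ range n,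
      if a (t + 1) = j then E.T (x (t + 1)) k - κ k else 0) atTop (𝓝 0)) :
    Tendsto (fun n => E.oddMean a x n j) atTop (𝓝 κ) := by
  have key : ∀ k, Tendsto (fun n => E.oddMean a x n j k) atTop (𝓝 (κ k)) := by
    intro k
    rw [tendsto_iff_norm_sub_tendsto_zero]
    have h1 := (h k).norm.const_mul c⁻¹
    rw [norm_zero, mul_zero] at h1
    refine squeeze_zero' (Eventually.of_forall fun n => norm_nonneg _) ?_ h1
    filter_upwards [hfreq, eventually_gt_atTop 0] with n hn hn0
    have hn0' : (0 : ℝ) < n := by positivity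
    have hN : 0 < (count a n j : ℝ) := by
      have := hc.trans_le hn
      rwa [freq, div_pos_iff_of_pos_right hn0'] at this
    have e : ∑ t ∈ range n, (if a (t + 1) = j then E.T (x (t + 1)) k - κ k else 0)
        = count a n j * (E.oddMean a x n j k - κ k) := by
      have e1 : (count a n j : ℝ) * E.oddMean a x n j k = E.armSum a x n j k := by
        rw [← count_smul_oddMean]; simp
      rw [mul_sub, e1, armSum, count, card_eq_sum_ones, sum_filter, sum_filter,
        range_eq_Ico, sum_Ico_add' (fun t => if a t = j then E.T (x t) k - κ k else 0) 0 n 1,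
        zero_add]
      have e2 : Ico 1 (n + 1) = Icc 1 n := by ext; simp
      rw [e2, WithLp.ofLp_sum, Finset.sum_apply, Nat.cast_sum, sum_mul, ← sum_sub_distrib]
      refine sum_congr rfl fun t _ => ?_
      split_ifs <;> simp
    rw [e, norm_mul, norm_mul, norm_inv, Real.norm_of_nonneg hN.le, Real.norm_of_nonneg hn0'.le,
      ← mul_assoc, ← mul_assoc]
    refine le_mul_of_one_le_left (norm_nonneg _) ?_
    rw [mul_assoc, ← div_eq_inv_mul, le_div_iff₀ hc, one_mul, ← div_eq_inv_mul]
    exact hn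
  have := (PiLp.continuous_toLp 2 fun _ : Fin d => ℝ).continuousAt.tendsto.comp
    (tendsto_pi_nhds.2 key)
  exact this

/-! ### Likelihoods -/

/-- The likelihood in terms of the empirical means. If all pulls are of arm `j`, the mean of the
other arms is a junk value and the formula fails. -/
lemma likelihood_eq (hj : count a n j < n) (η₁ η₂ : EuclideanSpace ℝ (Fin d)) :
    E.likelihood a x n j η₁ η₂ = (∏ t ∈ Icc 1 n, (E.h (x t) : ℝ≥0∞)) * ENNReal.ofReal (Real.exp
      (count a n j * (⟪η₁, E.oddMean a x n j⟫ - E.logPartition η₁)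
        + ((n : ℝ) - count a n j) * (⟪η₂, E.restMean a x n j⟫ - E.logPartition η₂))) := by
  have h1 : (n : ℝ) - count a n j ≠ 0 := by
    rw [sub_ne_zero]; exact_mod_cast hj.ne'
  rw [likelihood, ← count_smul_oddMean, mul_assoc, ← ENNReal.ofReal_mul (Real.exp_pos _).le,
    ← Real.exp_add, count_smul_oddMean]
  congr 4
  · rw [← count_smul_oddMean, real_inner_smul_right, mul_sub]
  · rw [restMean, real_inner_smul_right, mul_sub, mul_inv_cancel_left₀ h1]

/-- `n` times the profile at the empirical frequencies and means. -/
lemma mul_profile_eq (hn : 0 < n) (j : Fin K) :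
    n * E.profile (freq a n) (E.oddMean a x n) j
      = count a n j * E.conj (E.oddMean a x n j)
        + ((n : ℝ) - count a n j) * E.conj (E.restMean a x n j) := by
  have hn' : (n : ℝ) ≠ 0 := by positivity
  rw [profile, ← restMean_eq_mixMean a x hn, freq]
  field_simp

lemma likelihood_le (hj : count a n j < n) (hn : 0 < n)
    (h1 : E.oddMean a x n j ∈ E.conjDomain) (h2 : E.restMean a x n j ∈ E.conjDomain)
    (hη₁ : η₁ ∈ E.natSpace) (hη₂ : η₂ ∈ E.natSpace) :
    E.likelihood a x n j η₁ η₂ ≤ (∏ t ∈ Icc 1 n, (E.h (x t) : ℝ≥0∞)) *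
      ENNReal.ofReal (Real.exp (n * E.profile (freq a n) (E.oddMean a x n) j)) := by
  rw [likelihood_eq hj, mul_profile_eq hn]
  have h3 : (0 : ℝ) ≤ (n : ℝ) - count a n j := sub_nonneg.2 (by exact_mod_cast hj.le)
  gcongr
  · exact inner_sub_logPartition_le_conj hη₁ h1
  · exact inner_sub_logPartition_le_conj hη₂ h2

lemma maxLikelihood_le (hj : count a n j < n) (hn : 0 < n)
    (h1 : E.oddMean a x n j ∈ E.conjDomain) (h2 : E.restMean a x n j ∈ E.conjDomain) :
    E.maxLikelihood a x n j ≤ (∏ t ∈ Icc 1 n, (E.h (x t) : ℝ≥0∞)) *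
      ENNReal.ofReal (Real.exp (n * E.profile (freq a n) (E.oddMean a x n) j)) :=
  iSup₂_le fun _ hη₁ => iSup₂_le fun _ hη₂ => likelihood_le hj hn h1 h2 hη₁ hη₂

lemma le_likelihood (hj : count a n j < n) (hn : 0 < n) {ε : ℝ}
    (h1 : E.conj (E.oddMean a x n j) - ε ≤ ⟪η₁, E.oddMean a x n j⟫ - E.logPartition η₁)
    (h2 : E.conj (E.restMean a x n j) - ε ≤ ⟪η₂, E.restMean a x n j⟫ - E.logPartition η₂) :
    (∏ t ∈ Icc 1 n, (E.h (x t) : ℝ≥0∞)) *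
      ENNReal.ofReal (Real.exp (n * (E.profile (freq a n) (E.oddMean a x n) j - ε)))
      ≤ E.likelihood a x n j η₁ η₂ := by
  rw [likelihood_eq hj, mul_sub, mul_profile_eq hn]
  have h3 : (0 : ℝ) ≤ (n : ℝ) - count a n j := sub_nonneg.2 (by exact_mod_cast hj.le)
  have h4 := mul_le_mul_of_nonneg_left h1 (Nat.cast_nonneg (α := ℝ) (count a n j))
  have h5 := mul_le_mul_of_nonneg_left h2 h3
  gcongr
  nlinarith

lemma le_maxLikelihood (hne : E.natSpace.Nonempty) (hj : count a n j < n) (hn : 0 < n) {ε : ℝ}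
    (hε : 0 < ε) : (∏ t ∈ Icc 1 n, (E.h (x t) : ℝ≥0∞)) *
      ENNReal.ofReal (Real.exp (n * (E.profile (freq a n) (E.oddMean a x n) j - ε)))
      ≤ E.maxLikelihood a x n j := by
  have : Nonempty E.natSpace := hne.to_subtype
  obtain ⟨θ₁, h1⟩ := exists_lt_of_lt_ciSup (sub_lt_self (E.conj (E.oddMean a x n j)) hε)
  obtain ⟨θ₂, h2⟩ := exists_lt_of_lt_ciSup (sub_lt_self (E.conj (E.restMean a x n j)) hε)
  refine (le_likelihood hj hn h1.le h2.le).trans ?_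
  exact le_iSup₂_of_le θ₁.1 θ₁.2 (le_iSup₂_of_le θ₂.1 θ₂.2 le_rfl)

/-! ### The prior and the averaged likelihood -/

lemma Regular.aemeasurable_prior (hE : E.Regular) (τ : EuclideanSpace ℝ (Fin d)) (n₀ : ℝ) :
    AEMeasurable (E.prior τ n₀) (volume.restrict E.natSpace) := by
  have hA : AEMeasurable E.logPartition (volume.restrict E.natSpace) :=
    hE.contDiffOn_logPartition.continuousOn.aemeasurable hE.isOpen_natSpace.measurableSet
  unfold prior
  fun_prop

lemma setLIntegral_prior_natSpace_le_one (hE : E.Regular) :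
    ∫⁻ η in E.natSpace, E.prior τ n₀ η ≤ 1 := by
  have hA : AEMeasurable E.logPartition (volume.restrict E.natSpace) :=
    hE.contDiffOn_logPartition.continuousOn.aemeasurable hE.isOpen_natSpace.measurableSet
  unfold prior
  rw [lintegral_const_mul'' _ (by fun_prop)]
  exact ENNReal.inv_mul_le_one _

lemma setLIntegral_prior_ball_ne_zero (hE : E.Regular) (hprior : E.priorMass τ n₀ ≠ ∞) {r : ℝ}
    (hr : 0 < r) (hB : Metric.ball η r ⊆ E.natSpace) :
    ∫⁻ θ in Metric.ball η r, E.prior τ n₀ θ ≠ 0 := by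
  intro h
  rw [lintegral_eq_zero_iff' ((hE.aemeasurable_prior τ n₀).mono_measure
    (Measure.restrict_mono hB le_rfl))] at h
  have hpos : ∀ θ, E.prior τ n₀ θ ≠ 0 := fun θ =>
    mul_ne_zero (ENNReal.inv_ne_zero.2 hprior) (by simp [Real.exp_pos])
  have : (ae (volume.restrict (Metric.ball η r))).NeBot := by
    rw [ae_restrict_neBot]
    exact (Metric.measure_ball_pos volume η hr).ne'
  obtain ⟨θ, hθ⟩ := h.exists
  exact hpos θ hθ

lemma avgLikelihood_le (hE : E.Regular) {B : ℝ≥0∞}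
    (h : ∀ θ₁ ∈ E.natSpace, ∀ θ₂ ∈ E.natSpace, E.likelihood a x n j θ₁ θ₂ ≤ B) :
    E.avgLikelihood τ n₀ a x n j ≤ B := by
  have hm := hE.aemeasurable_prior τ n₀
  have hS := hE.isOpen_natSpace.measurableSet
  calc E.avgLikelihood τ n₀ a x n j
      ≤ ∫⁻ θ₁ in E.natSpace, ∫⁻ θ₂ in E.natSpace, B * E.prior τ n₀ θ₁ * E.prior τ n₀ θ₂ := by
        refine setLIntegral_mono' hS fun θ₁ h1 => setLIntegral_mono' hS fun θ₂ h2 => ?_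
        gcongr
        exact h θ₁ h1 θ₂ h2
    _ = B * (∫⁻ θ₁ in E.natSpace, E.prior τ n₀ θ₁) * ∫⁻ θ₂ in E.natSpace, E.prior τ n₀ θ₂ := by
        simp_rw [lintegral_const_mul'' _ hm]
        rw [lintegral_mul_const'' _ (hm.const_mul B), lintegral_const_mul'' _ hm]
    _ ≤ B * 1 * 1 := by
        gcongr <;> exact setLIntegral_prior_natSpace_le_one hE
    _ = B := by simp

lemma le_avgLikelihood (hE : E.Regular) {B : ℝ≥0∞} {r₁ r₂ : ℝ}
    (h1 : Metric.ball η₁ r₁ ⊆ E.natSpace) (h2 : Metric.ball η₂ r₂ ⊆ E.natSpace)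
    (h : ∀ θ₁ ∈ Metric.ball η₁ r₁, ∀ θ₂ ∈ Metric.ball η₂ r₂, B ≤ E.likelihood a x n j θ₁ θ₂) :
    B * ((∫⁻ θ in Metric.ball η₁ r₁, E.prior τ n₀ θ) * ∫⁻ θ in Metric.ball η₂ r₂, E.prior τ n₀ θ)
      ≤ E.avgLikelihood τ n₀ a x n j := by
  have hm1 := (hE.aemeasurable_prior τ n₀).mono_measure (Measure.restrict_mono h1 le_rfl)
  have hm2 := (hE.aemeasurable_prior τ n₀).mono_measure (Measure.restrict_mono h2 le_rfl)
  calc _ = ∫⁻ θ₁ in Metric.ball η₁ r₁, ∫⁻ θ₂ in Metric.ball η₂ r₂,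
          B * E.prior τ n₀ θ₁ * E.prior τ n₀ θ₂ := by
        simp_rw [lintegral_const_mul'' _ hm2]
        rw [lintegral_mul_const'' _ (hm1.const_mul B), lintegral_const_mul'' _ hm1, mul_assoc]
    _ ≤ ∫⁻ θ₁ in Metric.ball η₁ r₁, ∫⁻ θ₂ in Metric.ball η₂ r₂,
          E.likelihood a x n j θ₁ θ₂ * E.prior τ n₀ θ₁ * E.prior τ n₀ θ₂ := by
        refine setLIntegral_mono' measurableSet_ball fun θ₁ ht1 =>
          setLIntegral_mono' measurableSet_ball fun θ₂ ht2 => ?_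
        gcongr
        exact h θ₁ ht1 θ₂ ht2
    _ ≤ E.avgLikelihood τ n₀ a x n j := by
        refine lintegral_mono' (Measure.restrict_mono h1 le_rfl) fun θ₁ => ?_
        exact lintegral_mono' (Measure.restrict_mono h2 le_rfl) fun θ₂ => le_rfl

/-- Near `η` every parameter is almost a maximum likelihood estimate, as soon as the empirical mean
is close to `κ(η)`. -/
lemma Regular.exists_ball_conj_sub_le (hE : E.Regular) (h0 : ¬ ∀ᵐ x ∂E.ref, E.h x = 0)
    (hη : η ∈ E.natSpace) {u : ℕ → EuclideanSpace ℝ (Fin d)}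
    (hu : Tendsto u atTop (𝓝 (E.meanParam η))) {ε : ℝ} (hε : 0 < ε) :
    ∃ r > 0, Metric.ball η r ⊆ E.natSpace ∧ ∀ᶠ n in atTop, ∀ θ ∈ Metric.ball η r,
      E.conj (u n) - ε ≤ ⟪θ, u n⟫ - E.logPartition θ := by
  have hS := hE.isOpen_natSpace.mem_nhds hη
  have hA : ContinuousAt E.logPartition η :=
    hE.contDiffOn_logPartition.continuousOn.continuousAt hS
  have hf : ContinuousAt (fun θ => ⟪θ, E.meanParam η⟫ - E.logPartition θ) η := by fun_prop
  have hf' : ∀ᶠ θ in 𝓝 η, E.conj (E.meanParam η) - ε / 3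
      < ⟪θ, E.meanParam η⟫ - E.logPartition θ := by
    refine hf.eventually (lt_mem_nhds ?_)
    simp only [← hE.conj_meanParam h0 hη]
    linarith
  obtain ⟨r, hr, hball⟩ := Metric.nhds_basis_ball.mem_iff.1 (inter_mem hS hf')
  refine ⟨r, hr, fun θ h => (hball h).1, ?_⟩
  have h1 : Tendsto (fun n => (‖η‖ + r) * ‖u n - E.meanParam η‖) atTop (𝓝 0) := by
    simpa using (tendsto_iff_norm_sub_tendsto_zero.1 hu).const_mul (‖η‖ + r)
  have h2 := (continuousAt_conj ⟨η, hη⟩ (hE.meanParam_mem η hη)).tendsto.comp hu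
  have hε3 : 0 < ε / 3 := by positivity
  filter_upwards [h1.eventually (gt_mem_nhds hε3),
    h2.eventually (gt_mem_nhds (lt_add_of_pos_right _ hε3))] with n hn1 hn2 θ hθ
  have h3 : E.conj (E.meanParam η) - ε / 3 < ⟪θ, E.meanParam η⟫ - E.logPartition θ := (hball hθ).2
  have h4 : ‖θ‖ ≤ ‖η‖ + r := by
    have h5 := norm_le_norm_add_norm_sub' θ η
    have h6 := mem_ball_iff_norm.1 hθ
    linarith
  have h5 : -((‖η‖ + r) * ‖u n - E.meanParam η‖) ≤ ⟪θ, u n - E.meanParam η⟫ := by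
    refine le_trans (neg_le_neg ?_) (neg_le_of_abs_le (abs_real_inner_le_norm θ _))
    gcongr
  rw [inner_sub_right] at h5
  simp only [Function.comp_apply] at hn2
  linarith

/-! ### Asymptotics of the statistic along a trajectory -/

lemma log_div_le {H N D : ℝ≥0∞} (hH : H ≠ 0) (hH' : H ≠ ∞) {s t : ℝ}
    (hN : N ≤ H * ENNReal.ofReal (Real.exp s)) (hD : H * ENNReal.ofReal (Real.exp t) ≤ D) :
    ENNReal.log (N / D) ≤ ((s - t : ℝ) : EReal) := by
  have h := ENNReal.log_le_log (ENNReal.div_le_div hN hD)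
  rwa [ENNReal.mul_div_mul_left _ _ hH hH', ← ENNReal.ofReal_div_of_pos (Real.exp_pos t),
    ← Real.exp_sub, ENNReal.log_ofReal_of_pos (Real.exp_pos _), Real.log_exp] at h

lemma le_log_div {H N D : ℝ≥0∞} (hH : H ≠ 0) (hH' : H ≠ ∞) {s t : ℝ}
    (hN : H * ENNReal.ofReal (Real.exp s) ≤ N) (hD : D ≤ H * ENNReal.ofReal (Real.exp t)) :
    ((s - t : ℝ) : EReal) ≤ ENNReal.log (N / D) := by
  have h := ENNReal.log_le_log (ENNReal.div_le_div hN hD)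
  rwa [ENNReal.mul_div_mul_left _ _ hH hH', ← ENNReal.ofReal_div_of_pos (Real.exp_pos t),
    ← Real.exp_sub, ENNReal.log_ofReal_of_pos (Real.exp_pos _), Real.log_exp] at h

section Trajectory

variable (hE : E.Regular) (h0 : ¬ ∀ᵐ x ∂E.ref, E.h x = 0) (hK : 3 ≤ K)
  (hη₁ : η₁ ∈ E.natSpace) (hη₂ : η₂ ∈ E.natSpace)
  (hh : ∀ t, 1 ≤ t → E.h (x t) ≠ 0) {c : ℝ} (hc : 0 < c)
  (hfreq : ∀ᶠ n in atTop, ∀ l, c ≤ freq a n l)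
  (hmean : ∀ l, Tendsto (fun n => E.oddMean a x n l) atTop
    (𝓝 (armMean i (E.meanParam η₁) (E.meanParam η₂) l)))

include hK hc hfreq in
lemma eventually_count : ∀ᶠ n in atTop, 0 < n ∧ ∀ l, 0 < count a n l ∧ count a n l < n := by
  filter_upwards [hfreq, eventually_gt_atTop 0] with n hn hn0
  have hn0' : (0 : ℝ) < n := by positivity
  refine ⟨hn0, fun l => ⟨?_, ?_⟩⟩
  · have := hc.trans_le (hn l)
    rw [freq, div_pos_iff_of_pos_right hn0'] at this
    exact_mod_cast this
  · have := lt_one_of_pos hK (freq_mem_stdSimplex a hn0) (fun l => hc.trans_le (hn l)) l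
    rw [freq, div_lt_one hn0'] at this
    exact_mod_cast this

include hK hc hfreq hmean in
lemma tendsto_restMean :
    Tendsto (fun n => E.restMean a x n i) atTop (𝓝 (E.meanParam η₂)) := by
  have hsum : Tendsto (fun n => ∑ l, ‖E.oddMean a x n l
      - armMean i (E.meanParam η₁) (E.meanParam η₂) l‖) atTop (𝓝 (∑ _l : Fin K, (0 : ℝ))) :=
    tendsto_finsetSum _ fun l _ => tendsto_iff_norm_sub_tendsto_zero.1 (hmean l)
  rw [sum_const_zero] at hsum
  rw [tendsto_iff_norm_sub_tendsto_zero]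
  refine squeeze_zero' (Eventually.of_forall fun n => norm_nonneg _) ?_ hsum
  filter_upwards [hfreq, eventually_gt_atTop 0] with n hn hn0
  have hw := freq_mem_stdSimplex a hn0
  have hi := lt_one_of_pos hK hw (fun l => hc.trans_le (hn l)) i
  have h := norm_mixMean_sub_le hw hi (E.oddMean a x n)
    (armMean i (E.meanParam η₁) (E.meanParam η₂))
  rwa [mixMean_armMean_self hw hi, ← restMean_eq_mixMean a x hn0] at h

include hE hη₁ hη₂ hmean in
lemma Regular.eventually_oddMean_mem (j : Fin K) :
    ∀ᶠ n in atTop, E.oddMean a x n j ∈ interior E.conjDomain := by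
  refine (hmean j).eventually (isOpen_interior.mem_nhds ?_)
  unfold armMean
  split_ifs
  exacts [hE.meanParam_mem η₁ hη₁, hE.meanParam_mem η₂ hη₂]

include hE hK hη₁ hη₂ hc hfreq hmean in
lemma Regular.eventually_restMean_mem :
    ∀ᶠ n in atTop, ∀ j, E.restMean a x n j ∈ E.conjDomain := by
  filter_upwards [hfreq, eventually_gt_atTop 0,
    eventually_all.2 fun j => hE.eventually_oddMean_mem hη₁ hη₂ hmean j] with n hn hn0 hn1 j
  rw [restMean_eq_mixMean a x hn0]
  refine convexHull_min (Set.range_subset_iff.2 fun l => interior_subset (hn1 l))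
    (convexOn_conj ⟨η₁, hη₁⟩).1 (mixMean_mem_convexHull (freq_mem_stdSimplex a hn0) ?_ _)
  exact lt_one_of_pos hK (freq_mem_stdSimplex a hn0) (fun l => hc.trans_le (hn l)) j

include hE hK hη₁ hη₂ hh hc hfreq hmean in
/-- The averaged likelihood never exceeds the maximal one, for every hypothesis. -/
lemma Regular.eventually_pairGLR_le {ε : ℝ} (hε : 0 < ε) :
    ∀ᶠ n in atTop, ∀ k j, E.pairGLR τ n₀ a x n k j ≤
      ((n * (E.profile (freq a n) (E.oddMean a x n) k
        - E.profile (freq a n) (E.oddMean a x n) j + ε) : ℝ) : EReal) := by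
  filter_upwards [eventually_count hK hc hfreq,
    hE.eventually_restMean_mem hK hη₁ hη₂ hc hfreq hmean,
    eventually_all.2 fun j => hE.eventually_oddMean_mem hη₁ hη₂ hmean j] with n hn hn1 hn2 k j
  have hH : ∏ t ∈ Icc 1 n, (E.h (x t) : ℝ≥0∞) ≠ 0 :=
    prod_ne_zero_iff.2 fun t ht => by simpa using hh t (mem_Icc.1 ht).1
  have hH' : ∏ t ∈ Icc 1 n, (E.h (x t) : ℝ≥0∞) ≠ ∞ := ENNReal.prod_ne_top fun t _ => by simp
  have := log_div_le hH hH' (avgLikelihood_le (τ := τ) (n₀ := n₀) hE fun θ₁ h1 θ₂ h2 =>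
    likelihood_le (hn.2 k).2 hn.1 (interior_subset (hn2 k)) (hn1 k) h1 h2)
    (le_maxLikelihood ⟨η₁, hη₁⟩ (hn.2 j).2 hn.1 hε)
  refine this.trans (le_of_eq ?_)
  congr 1
  ring

include hE h0 hK hη₁ hη₂ hh hc hfreq hmean in
/-- Under the true hypothesis, the averaged likelihood is of the same exponential order as the
maximal one: the prior charges every neighbourhood of the true parameters. -/
lemma Regular.eventually_le_pairGLR (hprior : E.priorMass τ n₀ ≠ ∞) {ε : ℝ} (hε : 0 < ε) :
    ∀ᶠ n in atTop, ∀ j, ((n * (E.profile (freq a n) (E.oddMean a x n) i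
        - E.profile (freq a n) (E.oddMean a x n) j - ε) : ℝ) : EReal)
      ≤ E.pairGLR τ n₀ a x n i j := by
  have hodd : Tendsto (fun n => E.oddMean a x n i) atTop (𝓝 (E.meanParam η₁)) := by
    simpa [armMean] using hmean i
  have hrest := tendsto_restMean hK hc hfreq hmean
  obtain ⟨r₁, hr₁, hB₁, he₁⟩ := hE.exists_ball_conj_sub_le h0 hη₁ hodd (half_pos hε)
  obtain ⟨r₂, hr₂, hB₂, he₂⟩ := hE.exists_ball_conj_sub_le h0 hη₂ hrest (half_pos hε)
  set m := (∫⁻ θ in Metric.ball η₁ r₁, E.prior τ n₀ θ) * ∫⁻ θ in Metric.ball η₂ r₂, E.prior τ n₀ θ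
    with hm
  have hm0 : m ≠ 0 := mul_ne_zero (setLIntegral_prior_ball_ne_zero hE hprior hr₁ hB₁)
    (setLIntegral_prior_ball_ne_zero hE hprior hr₂ hB₂)
  -- the prior mass of the neighbourhoods is lost in the exponential scale
  have hlim : ∀ᶠ n : ℕ in atTop, ENNReal.ofReal (Real.exp (-(n * (ε / 2)))) ≤ m := by
    have h1 : Tendsto (fun n : ℕ => Real.exp (-(n * (ε / 2)))) atTop (𝓝 0) :=
      Real.tendsto_exp_neg_atTop_nhds_zero.comp
        (tendsto_natCast_atTop_atTop.atTop_mul_const (half_pos hε))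
    have h2 := (ENNReal.tendsto_ofReal h1).eventually
      (gt_mem_nhds (by simpa using pos_iff_ne_zero.2 hm0))
    exact h2.mono fun n hn => hn.le
  filter_upwards [eventually_count hK hc hfreq,
    hE.eventually_restMean_mem hK hη₁ hη₂ hc hfreq hmean,
    eventually_all.2 fun j => hE.eventually_oddMean_mem hη₁ hη₂ hmean j,
    he₁, he₂, hlim] with n hn hn1 hn2 hn3 hn4 hn5 j
  have hH : ∏ t ∈ Icc 1 n, (E.h (x t) : ℝ≥0∞) ≠ 0 :=
    prod_ne_zero_iff.2 fun t ht => by simpa using hh t (mem_Icc.1 ht).1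
  have hH' : ∏ t ∈ Icc 1 n, (E.h (x t) : ℝ≥0∞) ≠ ∞ := ENNReal.prod_ne_top fun t _ => by simp
  have havg := le_avgLikelihood (τ := τ) (n₀ := n₀) hE hB₁ hB₂ fun θ₁ h1 θ₂ h2 =>
    le_likelihood (hn.2 i).2 hn.1 (hn3 θ₁ h1) (hn4 θ₂ h2)
  have h3 : (∏ t ∈ Icc 1 n, (E.h (x t) : ℝ≥0∞)) * ENNReal.ofReal (Real.exp
      (n * (E.profile (freq a n) (E.oddMean a x n) i - ε))) ≤ E.avgLikelihood τ n₀ a x n i := by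
    refine le_trans ?_ havg
    have e : (n * (E.profile (freq a n) (E.oddMean a x n) i - ε) : ℝ)
      = n * (E.profile (freq a n) (E.oddMean a x n) i - ε / 2) + -(n * (ε / 2)) := by ring
    rw [e, Real.exp_add, ENNReal.ofReal_mul (Real.exp_pos _).le, ← mul_assoc]
    gcongr
  have := le_log_div hH hH' h3
    (maxLikelihood_le (hn.2 j).2 hn.1 (interior_subset (hn2 j)) (hn1 j))
  refine le_trans (le_of_eq ?_) this
  congr 1
  ring

include hE hη₁ hη₂ hK hc hfreq hmean in
lemma Regular.eventually_abs_profile_sub_lt {ε : ℝ} (hε : 0 < ε) :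
    ∀ᶠ n in atTop, ∀ j, |E.profile (freq a n) (E.oddMean a x n) j
      - E.profile (freq a n) (armMean i (E.meanParam η₁) (E.meanParam η₂)) j| < ε :=
  eventually_all.2 fun j => by
    have h : Tendsto (fun n => E.profile (freq a n) (E.oddMean a x n) j
        - E.profile (freq a n) (armMean i (E.meanParam η₁) (E.meanParam η₂)) j) atTop (𝓝 0) := by
      refine tendsto_profile_sub ⟨η₁, hη₁⟩ (fun l => ?_) hmean ?_
      · unfold armMean
        split_ifs
        exacts [hE.meanParam_mem η₁ hη₁, hE.meanParam_mem η₂ hη₂]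
      · filter_upwards [hfreq, eventually_gt_atTop 0] with n hn hn0
        have hw := freq_mem_stdSimplex a hn0
        exact ⟨hw, lt_one_of_pos hK hw (fun l => hc.trans_le (hn l)) j⟩
    exact (tendsto_zero_iff_norm_tendsto_zero.1 h).eventually (gt_mem_nhds hε)

include hE h0 hK hη₁ hη₂ hh hc hfreq hmean in
/-- The statistic of the true hypothesis is `n` times the value of the sampling frequencies, up to
`o(n)`. -/
lemma Regular.eventually_GLR_bounds (hprior : E.priorMass τ n₀ ≠ ∞) {ε : ℝ} (hε : 0 < ε) :
    ∀ᶠ n in atTop,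
      ((n * (E.allocValue i η₁ η₂ (freq a n) - ε) : ℝ) : EReal) ≤ E.GLR τ n₀ a x n i ∧
      E.GLR τ n₀ a x n i ≤ ((n * (E.allocValue i η₁ η₂ (freq a n) + ε) : ℝ) : EReal) := by
  have hε4 : 0 < ε / 4 := by positivity
  filter_upwards [hfreq, eventually_gt_atTop 0,
    hE.eventually_pairGLR_le (τ := τ) (n₀ := n₀) hK hη₁ hη₂ hh hc hfreq hmean hε4,
    hE.eventually_le_pairGLR h0 hK hη₁ hη₂ hh hc hfreq hmean hprior hε4,
    hE.eventually_abs_profile_sub_lt hK hη₁ hη₂ hc hfreq hmean hε4] with n hn hn0 h1 h2 h3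
  have hiff := fun b => hE.le_allocValue_iff (i := i) h0 hK hη₁ hη₂ (freq_mem_stdSimplex a hn0)
    (fun l => hc.trans_le (hn l)) (c := b)
  have hi := abs_lt.1 (h3 i)
  constructor
  · refine le_iInf fun j => le_trans ?_ (h2 j)
    have h4 := (hiff _).1 le_rfl j j.2
    have hj := abs_lt.1 (h3 j)
    rw [EReal.coe_le_coe_iff]
    exact mul_le_mul_of_nonneg_left (by linarith) (Nat.cast_nonneg n)
  · have h4 := (hiff (E.allocValue i η₁ η₂ (freq a n) + ε / 4)).not.1 (by linarith)
    push Not at h4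
    obtain ⟨j, hj, h5⟩ := h4
    refine (iInf_le _ (⟨j, hj⟩ : {j : Fin K // j ≠ i})).trans ((h1 i j).trans ?_)
    have hj := abs_lt.1 (h3 j)
    rw [EReal.coe_le_coe_iff]
    exact mul_le_mul_of_nonneg_left (by linarith) (Nat.cast_nonneg n)

include hE h0 hK hη₁ hη₂ hh hc hfreq hmean in
/-- Eventually the true odd arm is the only leader: its statistic grows linearly, while the
statistic of any other arm is at most its comparison with the true one, which is negative. -/
lemma Regular.eventually_leaders (hne : η₁ ≠ η₂) (hprior : E.priorMass τ n₀ ≠ ∞) :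
    ∀ᶠ n in atTop, ∀ m ∈ E.leaders τ n₀ a x n, m = i := by
  have hu := uniform_mem_stdSimplex hK
  have hK0 : (0 : ℝ) < (K : ℝ)⁻¹ := by positivity
  set δ := c * E.allocValue i η₁ η₂ (fun _ => (K : ℝ)⁻¹) with hδ
  have hδ0 : 0 < δ := mul_pos hc (hE.allocValue_pos h0 hK hη₁ hη₂ hne hu fun _ => hK0)
  have hδ4 : 0 < δ / 4 := by positivity
  filter_upwards [hfreq, eventually_gt_atTop 0,
    hE.eventually_pairGLR_le (τ := τ) (n₀ := n₀) hK hη₁ hη₂ hh hc hfreq hmean hδ4,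
    hE.eventually_GLR_bounds h0 hK hη₁ hη₂ hh hc hfreq hmean hprior hδ4,
    hE.eventually_abs_profile_sub_lt hK hη₁ hη₂ hc hfreq hmean hδ4] with n hn hn0 h1 h2 h3 m hm
  by_contra hmi
  have hw := freq_mem_stdSimplex a hn0
  have hn0' : (0 : ℝ) < n := by positivity
  have hval : δ ≤ E.allocValue i η₁ η₂ (freq a n) :=
    mul_allocValue_le hK ⟨η₁, hη₁⟩ hw hu hc.le fun l => by
      refine le_trans (mul_le_of_le_one_right hc.le (inv_le_one_of_one_le₀ ?_)) (hn l)
      exact_mod_cast (by omega : 1 ≤ K)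
  have hgap := (hE.le_allocValue_iff (i := i) h0 hK hη₁ hη₂ hw
    (fun l => hc.trans_le (hn l))).1 hval m hmi
  have hi := abs_lt.1 (h3 i)
  have hm' := abs_lt.1 (h3 m)
  have hle : E.GLR τ n₀ a x n i ≤ E.GLR τ n₀ a x n m := by
    have := (Finset.mem_filter.1 hm).2
    exact this i
  have h4 := h2.1.trans (hle.trans ((iInf_le _ (⟨i, Ne.symm hmi⟩ : {j : Fin K // j ≠ m})).trans
    (h1 m i)))
  rw [EReal.coe_le_coe_iff] at h4
  have h5 := le_of_mul_le_mul_left h4 hn0'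
  linarith

include hE h0 hK hη₁ hη₂ hc hfreq hmean in
lemma Regular.eventually_estimatesOK (hne : η₁ ≠ η₂) :
    ∀ᶠ n in atTop, E.EstimatesOK a x n i := by
  have hodd : Tendsto (fun n => E.oddMean a x n i) atTop (𝓝 (E.meanParam η₁)) := by
    simpa [armMean] using hmean i
  have hrest := tendsto_restMean hK hc hfreq hmean
  have hκ : E.meanParam η₁ ≠ E.meanParam η₂ := fun h => hne (by
    rw [← hE.natParam_meanParam h0 hη₁, h, hE.natParam_meanParam h0 hη₂])
  obtain ⟨V, W, hV, hW, hVη, hWη, hVW⟩ := t2_separation hκ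
  filter_upwards [eventually_count hK hc hfreq,
    hodd.eventually (hE.image_meanParam_mem_nhds h0 hη₁),
    hrest.eventually (hE.image_meanParam_mem_nhds h0 hη₂),
    hodd.eventually (hV.mem_nhds hVη), hrest.eventually (hW.mem_nhds hWη)] with n hn h1 h2 h3 h4
  refine ⟨(hn.2 i).1, (hn.2 i).2, h1, h2, fun h => ?_⟩
  obtain ⟨θ₁, ht1, e1⟩ := h1
  obtain ⟨θ₂, ht2, e2⟩ := h2
  rw [← e1, ← e2, hE.natParam_meanParam h0 ht1, hE.natParam_meanParam h0 ht2] at h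
  refine Set.disjoint_left.1 hVW h3 ?_
  rwa [← e1, h, e2]

include hE h0 hK hη₁ hη₂ hh hc hfreq hmean in
lemma Regular.tendsto_GLR_div (hprior : E.priorMass τ n₀ ≠ ∞) {D : ℝ}
    (hval : Tendsto (fun n => E.allocValue i η₁ η₂ (freq a n)) atTop (𝓝 D)) :
    Tendsto (fun n : ℕ => E.GLR τ n₀ a x n i / ((n : ℝ) : EReal)) atTop (𝓝 (D : EReal)) := by
  have key : ∀ ε > 0, ∀ᶠ n : ℕ in atTop,
      ((E.allocValue i η₁ η₂ (freq a n) - ε : ℝ) : EReal)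
        ≤ E.GLR τ n₀ a x n i / ((n : ℝ) : EReal) ∧
      E.GLR τ n₀ a x n i / ((n : ℝ) : EReal)
        ≤ ((E.allocValue i η₁ η₂ (freq a n) + ε : ℝ) : EReal) := by
    intro ε hε
    filter_upwards [eventually_gt_atTop 0,
      hE.eventually_GLR_bounds h0 hK hη₁ hη₂ hh hc hfreq hmean hprior hε] with n hn0 h
    have hn0' : (0 : EReal) < ((n : ℝ) : EReal) := by exact_mod_cast hn0
    rw [EReal.le_div_iff_mul_le hn0' (EReal.coe_ne_top _),
      EReal.div_le_iff_le_mul hn0' (EReal.coe_ne_top _), ← EReal.coe_mul, ← EReal.coe_mul]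
    rw [mul_comm _ (n : ℝ)]
    exact h
  refine tendsto_order.2 ⟨fun b hb => ?_, fun b hb => ?_⟩
  · obtain ⟨b', h1, h2⟩ := EReal.lt_iff_exists_real_btwn.1 hb
    have h2 : 0 < (D - b') / 2 := by have := EReal.coe_lt_coe_iff.1 h2; linarith
    filter_upwards [key _ h2, hval.eventually (lt_mem_nhds (sub_lt_self D h2))] with n hn hn'
    refine h1.trans_le (le_trans ?_ hn.1)
    rw [EReal.coe_le_coe_iff]
    linarith
  · obtain ⟨b', h1, h2⟩ := EReal.lt_iff_exists_real_btwn.1 hb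
    have h1 : 0 < (b' - D) / 2 := by have := EReal.coe_lt_coe_iff.1 h1; linarith
    filter_upwards [key _ h1, hval.eventually (gt_mem_nhds (lt_add_of_pos_right D h1))]
      with n hn hn'
    refine (hn.2.trans ?_).trans_lt h2
    rw [EReal.coe_le_coe_iff]
    linarith

end Trajectory

end ExpFamily

/-! ### Conditional laws -/

section ConditionalLaws

variable {Ω S : Type*} [MeasurableSpace S] {m m0 : MeasurableSpace Ω} {P : Measure Ω}

/-- The relative frequency of events follows the average of their conditional probabilities. -/
theorem ae_tendsto_average_indicator_sub [IsProbabilityMeasure P] {ℱ : Filtration ℕ m0}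
    {B : ℕ → Set Ω} {p : ℕ → Ω → ℝ} (hB : ∀ t, MeasurableSet[ℱ (t + 1)] (B t))
    (hp : ∀ t, P⟦B t | ℱ t⟧ =ᵐ[P] p t) (hp01 : ∀ t ω, p t ω ∈ Set.Icc (0 : ℝ) 1) :
    ∀ᵐ ω ∂P, Tendsto (fun n : ℕ => (n : ℝ)⁻¹ * ∑ t ∈ range n,
      ((B t).indicator (fun _ => (1 : ℝ)) ω - p t ω)) atTop (𝓝 0) := by
  set D : ℕ → Ω → ℝ := fun t => (B t).indicator (fun _ => (1 : ℝ)) - P⟦B t | ℱ t⟧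
  have hind : ∀ t, MemLp ((B t).indicator fun _ => (1 : ℝ)) 2 P := fun t =>
    memLp_indicator_const 2 (ℱ.le _ _ (hB t)) 1 (Or.inr (measure_ne_top P _))
  have hL2 : ∀ t, MemLp (D t) 2 P := fun t => (hind t).sub (MemLp.condExp (by norm_num) (hind t))
  have hae : ∀ᵐ ω ∂P, ∀ t, D t ω = (B t).indicator (fun _ => (1 : ℝ)) ω - p t ω :=
    ae_all_iff.2 fun t => by
      filter_upwards [hp t] with ω hω
      simp [D, hω]
  have h := ae_tendsto_average_martingaleDifference (P := P) (ℱ := ℱ) (D := D) (C := 1)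
    (fun t => (stronglyMeasurable_const.indicator (hB t)).sub
      (stronglyMeasurable_condExp.mono (ℱ.mono t.le_succ))) hL2 (fun t => ?_) (fun t => ?_)
  · filter_upwards [h, hae] with ω h1 h2
    simpa only [h2] using h1
  · have : ∫ ω, D t ω ^ 2 ∂P ≤ ∫ _, (1 : ℝ) ∂P := by
      refine integral_mono_ae (hL2 t).integrable_sq (integrable_const _) ?_
      filter_upwards [hae] with ω hω
      rw [hω t, sq_le_one_iff_abs_le_one, abs_le]
      have := hp01 t ω
      by_cases hmem : ω ∈ B t <;> simp only [hmem, Set.indicator_of_mem, Set.indicator_of_notMem,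
        not_false_eq_true] <;> constructor <;> linarith [this.1, this.2]
    simpa using this
  · have h1 := condExp_sub ((hind t).integrable (by norm_num))
      (integrable_condExp (μ := P) (m := ℱ t) (f := (B t).indicator fun _ => (1 : ℝ))) (ℱ t)
    filter_upwards [h1] with ω h1
    rw [h1, condExp_of_stronglyMeasurable (ℱ.le t) stronglyMeasurable_condExp integrable_condExp]
    simp

/-- If `X` has conditional law `ν` given `m` on the event `C`, then on `m`-measurable subsets of `C`
it is independent with law `ν`. -/
lemma map_restrict_of_condLaw [IsProbabilityMeasure P] (hm : m ≤ m0) {X : Ω → S}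
    (hX : Measurable X) {ν : Measure S} [IsFiniteMeasure ν] {C : Set Ω}
    (hlaw : ∀ B, MeasurableSet B → ∀ᵐ ω ∂P, ω ∈ C → (P⟦X ⁻¹' B | m⟧) ω = ν.real B)
    {C' : Set Ω} (hC' : MeasurableSet[m] C') (hsub : C' ⊆ C) :
    (P.restrict C').map X = P C' • ν := by
  ext B hB
  have h1 : ∫ ω in C', (P⟦X ⁻¹' B | m⟧) ω ∂P = ∫ _ in C', ν.real B ∂P := by
    refine setIntegral_congr_ae (hm _ hC') ?_
    filter_upwards [hlaw B hB] with ω hω hmem using hω (hsub hmem)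
  rw [setIntegral_condExp hm ((integrable_const _).indicator (hX hB)) hC',
    integral_indicator (hX hB), Measure.restrict_restrict (hX hB)] at h1
  simp only [integral_const, measureReal_restrict_apply_univ, smul_eq_mul, mul_one] at h1
  rw [Measure.map_apply hX hB, Measure.restrict_apply (hX hB), Measure.smul_apply, smul_eq_mul]
  rw [← ENNReal.toReal_eq_toReal_iff' (measure_ne_top _ _)
    (ENNReal.mul_ne_top (measure_ne_top _ _) (measure_ne_top _ _)), ENNReal.toReal_mul]
  exact h1

/-- Strong law of large numbers for observations made at predictable times `C t` whose conditional
law is `ν`. -/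
theorem ae_tendsto_average_of_condLaw [IsProbabilityMeasure P] {ℱ : Filtration ℕ m0}
    {X : ℕ → Ω → S} (hX : ∀ t, Measurable[ℱ (t + 1)] (X t)) {ν : Measure S}
    [IsProbabilityMeasure ν] {C : ℕ → Set Ω} (hC : ∀ t, MeasurableSet[ℱ t] (C t))
    (hlaw : ∀ t B, MeasurableSet B → ∀ᵐ ω ∂P, ω ∈ C t → (P⟦X t ⁻¹' B | ℱ t⟧) ω = ν.real B)
    {g : S → ℝ} (hgm : Measurable g) (hg : MemLp g 2 ν) :
    ∀ᵐ ω ∂P, Tendsto (fun n : ℕ => (n : ℝ)⁻¹ * ∑ t ∈ range n,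
      (C t).indicator (fun ω => g (X t ω) - ∫ y, g y ∂ν) ω) atTop (𝓝 0) := by
  set f : S → ℝ := fun y => g y - ∫ y, g y ∂ν
  have hfm : Measurable f := hgm.sub_const _
  have hf : MemLp f 2 ν := hg.sub (memLp_const _)
  have hX' : ∀ t, Measurable (X t) := fun t => (hX t).mono (ℱ.le _) le_rfl
  have hC0 : ∀ t, MeasurableSet (C t) := fun t => ℱ.le t _ (hC t)
  have hmap : ∀ t C', MeasurableSet[ℱ t] C' → C' ⊆ C t → (P.restrict C').map (X t) = P C' • ν :=
    fun t C' h1 h2 => map_restrict_of_condLaw (ℱ.le t) (hX' t) (hlaw t) h1 h2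
  have hL2 : ∀ t, MemLp ((C t).indicator fun ω => f (X t ω)) 2 P := by
    intro t
    rw [memLp_indicator_iff_restrict (hC0 t)]
    have h1 : MemLp f 2 ((P.restrict (C t)).map (X t)) := by
      rw [hmap t _ (hC t) subset_rfl]
      exact hf.smul_measure (measure_ne_top _ _)
    exact h1.comp_of_map (hX' t).aemeasurable
  refine ae_tendsto_average_martingaleDifference (ℱ := ℱ) (C := ∫ y, f y ^ 2 ∂ν) (fun t => ?_) hL2
    (fun t => ?_) (fun t => ?_)
  · exact ((hfm.comp (hX t)).stronglyMeasurable).indicator (ℱ.mono t.le_succ _ (hC t))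
  · have e : ∀ ω, (C t).indicator (fun ω => f (X t ω)) ω ^ 2
        = (C t).indicator (fun ω => f (X t ω) ^ 2) ω := fun ω => by
      by_cases h : ω ∈ C t <;> simp [h]
    refine (integral_congr_ae (ae_of_all P e)).le.trans ?_
    rw [integral_indicator (hC0 t), ← integral_map (φ := X t) (f := fun y => f y ^ 2)
      (hX' t).aemeasurable (by fun_prop), hmap t _ (hC t) subset_rfl, integral_smul_measure]
    exact mul_le_of_le_one_left (integral_nonneg fun y => sq_nonneg _)
      (ENNReal.toReal_mono ENNReal.one_ne_top prob_le_one)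
  · refine (ae_eq_condExp_of_forall_setIntegral_eq (ℱ.le t) ((hL2 t).integrable (by norm_num))
      (fun _ _ _ => integrableOn_zero) (fun s hs _ => ?_) aestronglyMeasurable_zero).symm
    have hs' : MeasurableSet[ℱ t] (C t ∩ s) := (hC t).inter hs
    rw [integral_indicator (hC0 t), Measure.restrict_restrict (hC0 t),
      ← integral_map (φ := X t) (f := f) (hX' t).aemeasurable hfm.aestronglyMeasurable,
      hmap t _ hs' Set.inter_subset_left, integral_smul_measure]
    have h1 : ∫ y, f y ∂ν = 0 := by
      change ∫ y, (g y - ∫ y, g y ∂ν) ∂ν = 0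
      rw [integral_sub (hg.integrable (by norm_num)) (integrable_const _)]
      simp
    simp [h1]

/-- An event almost surely avoids the zeros of its conditional probability. -/
lemma ae_imp_condExp_indicator_ne_zero [IsProbabilityMeasure P] (hm : m ≤ m0) {B : Set Ω}
    (hB : MeasurableSet B) : ∀ᵐ ω ∂P, ω ∈ B → (P⟦B | m⟧) ω ≠ 0 := by
  have hZ : MeasurableSet[m] {ω | (P⟦B | m⟧) ω = 0} :=
    stronglyMeasurable_condExp.measurable (measurableSet_singleton 0)
  have h1 := setIntegral_condExp (μ := P) hm ((integrable_const (1 : ℝ)).indicator hB) hZ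
  rw [setIntegral_congr_fun (g := fun _ => (0 : ℝ)) (hm _ hZ) fun ω hω => hω,
    integral_indicator hB, Measure.restrict_restrict hB] at h1
  simp only [integral_const, measureReal_restrict_apply_univ, smul_eq_mul, mul_zero, mul_one] at h1
  have h2 : P (B ∩ {ω | (P⟦B | m⟧) ω = 0}) = 0 := by
    rwa [eq_comm, measureReal_eq_zero_iff] at h1
  filter_upwards [measure_eq_zero_iff_ae_notMem.1 h2] with ω hω hmem h0
  exact hω ⟨hmem, h0⟩

end ConditionalLaws

/-- Averages may be shifted by one unit of time. -/
lemma tendsto_average_of_shift {f : ℕ → ℝ}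
    (h : Tendsto (fun n : ℕ => (n : ℝ)⁻¹ * ∑ t ∈ range n, f (t + 1)) atTop (𝓝 0)) :
    Tendsto (fun n : ℕ => (n : ℝ)⁻¹ * ∑ t ∈ range n, f t) atTop (𝓝 0) := by
  rw [← tendsto_add_atTop_iff_nat 1]
  have h1 : Tendsto (fun n : ℕ => ((n + 1 : ℕ) : ℝ)⁻¹ * f 0) atTop (𝓝 0) := by
    simpa using ((tendsto_inv_atTop_nhds_zero_nat (𝕜 := ℝ)).comp
      (tendsto_add_atTop_nat 1)).mul_const (f 0)
  have h2 := h1.norm.add h.norm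
  simp only [norm_zero, add_zero] at h2
  refine squeeze_zero_norm' ?_ h2
  filter_upwards [eventually_gt_atTop 0] with n hn
  rw [sum_range_succ', mul_add, add_comm]
  refine (norm_add_le _ _).trans (add_le_add le_rfl ?_)
  rw [norm_mul, norm_mul]
  refine mul_le_mul_of_nonneg_right ?_ (norm_nonneg _)
  rw [norm_inv, norm_inv, Real.norm_natCast, Real.norm_natCast]
  have : (0 : ℝ) < n := by positivity
  gcongr
  exact n.le_succ

/-! ### The sluggish policy -/

section Policy

variable {Ω S : Type*} [MeasurableSpace S] {d K : ℕ}
  {A : ℕ → Ω → Fin K} {X : ℕ → Ω → S} {U : ℕ → Ω → Bool} {I : ℕ → Ω → Fin K} {n : ℕ}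

lemma pastField_le_leaderField : pastField A X U I n ≤ leaderField A X U I n := le_sup_left

lemma leaderField_le_pullField : leaderField A X U I n ≤ pullField A X U I n :=
  le_sup_left.trans le_sup_left

/-- The leader at time `0` is not recorded in later fields, hence `1 ≤ n`. -/
lemma leaderField_le_pastField (hn : 1 ≤ n) :
    leaderField A X U I n ≤ pastField A X U I (n + 1) := by
  refine sup_le (sup_le_sup ?_ ?_) (le_sup_of_le_right ?_)
  · exact biSup_mono fun t ht => by simp only [Finset.mem_Icc] at ht ⊢; omega
  · exact biSup_mono fun t ht => by simp only [Finset.mem_Ico] at ht ⊢; omega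
  · exact le_iSup₂_of_le n (by simp only [Finset.mem_Ico]; omega) le_rfl

lemma step_le_pastField {t : ℕ} (ht : 1 ≤ t) (htn : t ≤ n) :
    (⊤ : MeasurableSpace (Fin K)).comap (A t) ⊔ MeasurableSpace.comap (X t) inferInstance
      ⊔ (⊤ : MeasurableSpace Bool).comap (U t) ≤ pastField A X U I n :=
  le_sup_of_le_left (le_iSup₂_of_le t (Finset.mem_Icc.2 ⟨ht, htn⟩) le_rfl)

lemma measurable_arm_pastField {t : ℕ} (ht : 1 ≤ t) (htn : t ≤ n) :
    Measurable[pastField A X U I n] (A t) :=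
  (comap_measurable (A t)).mono ((le_sup_left.trans le_sup_left).trans
    (step_le_pastField ht htn)) le_rfl

lemma measurable_obs_pastField {t : ℕ} (ht : 1 ≤ t) (htn : t ≤ n) :
    Measurable[pastField A X U I n] (X t) :=
  (comap_measurable (X t)).mono ((le_sup_right.trans le_sup_left).trans
    (step_le_pastField ht htn)) le_rfl

lemma measurable_coin_pastField {t : ℕ} (ht : 1 ≤ t) (htn : t ≤ n) :
    Measurable[pastField A X U I n] (U t) :=
  (comap_measurable (U t)).mono (le_sup_right.trans (step_le_pastField ht htn)) le_rfl

lemma pullField_le_pastField (hn : 1 ≤ n) : pullField A X U I n ≤ pastField A X U I (n + 1) := by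
  refine sup_le (sup_le (leaderField_le_pastField hn) ?_) ?_
  · exact (measurable_coin_pastField (by omega) le_rfl).comap_le
  · exact (measurable_arm_pastField (by omega) le_rfl).comap_le

variable [MeasurableSpace Ω] {E : ExpFamily S d} {τ η₁ η₂ : EuclideanSpace ℝ (Fin d)}
  {n₀ γ c₀ : ℝ} {i : Fin K} {P : Measure Ω} {Q : ℕ → Ω → Fin K → ℝ}

namespace FollowsSluggishGLR

variable (hpol : FollowsSluggishGLR E τ n₀ γ c₀ i η₁ η₂ P A X U I Q)

include hpol

lemma pastField_le (n : ℕ) : pastField A X U I n ≤ ‹MeasurableSpace Ω› :=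
  sup_le (iSup₂_le fun t _ => sup_le (sup_le (hpol.measurable_A t).comap_le
    (hpol.measurable_X t).comap_le) (hpol.measurable_U t).comap_le)
    (iSup₂_le fun t _ => (hpol.measurable_I t).comap_le)

lemma pullField_le (n : ℕ) : pullField A X U I n ≤ ‹MeasurableSpace Ω› :=
  sup_le (sup_le (sup_le (hpol.pastField_le n) (hpol.measurable_I n).comap_le)
    (hpol.measurable_U (n + 1)).comap_le) (hpol.measurable_A (n + 1)).comap_le

lemma leaderField_le (n : ℕ) : leaderField A X U I n ≤ ‹MeasurableSpace Ω› :=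
  leaderField_le_pullField.trans (hpol.pullField_le n)

/-- The fields preceding the draws of the arms, from time `1` on. -/
def leaderFiltration : Filtration ℕ ‹MeasurableSpace Ω› where
  seq t := leaderField A X U I (t + 1)
  mono' := monotone_nat_of_le_succ fun t =>
    (leaderField_le_pastField (by omega)).trans pastField_le_leaderField
  le' t := hpol.leaderField_le (t + 1)

/-- The fields preceding the observations, from time `1` on. -/
def pullFiltration : Filtration ℕ ‹MeasurableSpace Ω› where
  seq t := pullField A X U I (t + 1)
  mono' := monotone_nat_of_le_succ fun t => (pullField_le_pastField (by omega)).trans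
    (pastField_le_leaderField.trans leaderField_le_pullField)
  le' t := hpol.pullField_le (t + 1)

lemma ae_mem_leaders [IsProbabilityMeasure P] : ∀ᵐ ω ∂P, ∀ n, 1 ≤ n →
    I n ω ∈ E.leaders τ n₀ (A · ω) (X · ω) n := by
  have h : ∀ n, 1 ≤ n → ∀ m, ∀ᵐ ω ∂P, I n ω = m → m ∈ E.leaders τ n₀ (A · ω) (X · ω) n := by
    intro n hn m
    filter_upwards [hpol.leader n hn m, ae_imp_condExp_indicator_ne_zero (P := P)
      (hpol.pastField_le n) (hpol.measurable_I n (measurableSet_singleton m))] with ω h1 h2 h3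
    have h4 := h2 h3
    rw [h1] at h4
    by_contra hc
    exact h4 (if_neg hc)
  have h' : ∀ᵐ ω ∂P, ∀ n, 1 ≤ n → ∀ m, I n ω = m → m ∈ E.leaders τ n₀ (A · ω) (X · ω) n :=
    ae_all_iff.2 fun n => by
      by_cases hn : 1 ≤ n
      · filter_upwards [ae_all_iff.2 (h n hn)] with ω hω _ using hω
      · exact ae_of_all _ fun ω h => absurd h hn
  filter_upwards [h'] with ω hω n hn using hω n hn _ rfl

lemma ae_h_ne_zero [IsProbabilityMeasure P] : ∀ᵐ ω ∂P, ∀ t, 1 ≤ t → E.h (X t ω) ≠ 0 := by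
  have hB : MeasurableSet {y | E.h y = 0} := E.measurable_h (measurableSet_singleton 0)
  have hlaw : ∀ θ, E.law θ {y | E.h y = 0} = 0 := by
    intro θ
    rw [ExpFamily.law, withDensity_apply _ hB, setLIntegral_congr_fun (g := fun _ => 0) hB
      fun y hy => by simp only [Set.mem_ofPred_eq] at hy; simp [ExpFamily.density, hy]]
    simp
  refine ae_all_iff.2 fun t => ?_
  rcases Nat.eq_zero_or_pos t with rfl | ht
  · exact ae_of_all _ fun ω h => absurd h (by norm_num)
  obtain ⟨n, rfl⟩ : ∃ n, t = n + 1 := ⟨t - 1, by omega⟩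
  filter_upwards [hpol.observe n _ hB, ae_imp_condExp_indicator_ne_zero (P := P)
    (hpol.pullField_le n) (hpol.measurable_X (n + 1) hB)] with ω h1 h2 _ h3
  refine h2 h3 ?_
  rw [h1, measureReal_def, hlaw, ENNReal.toReal_zero]

/-- The laws of large numbers for the observations of each arm. -/
lemma ae_tendsto_average_obs [IsProbabilityMeasure P] (hE : E.Regular)
    (h0 : ¬ ∀ᵐ x ∂E.ref, E.h x = 0) (hη₁ : η₁ ∈ E.natSpace) (hη₂ : η₂ ∈ E.natSpace)
    (j : Fin K) (k : Fin d) :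
    ∀ᵐ ω ∂P, Tendsto (fun n : ℕ => (n : ℝ)⁻¹ * ∑ t ∈ range n,
      if A (t + 1) ω = j then E.T (X (t + 1) ω) k
        - ExpFamily.armMean i (E.meanParam η₁) (E.meanParam η₂) j k else 0) atTop (𝓝 0) := by
  set θ := if j = i then η₁ else η₂ with hθ
  have hθm : θ ∈ E.natSpace := by rw [hθ]; split_ifs <;> assumption
  have hκ : ExpFamily.armMean i (E.meanParam η₁) (E.meanParam η₂) j = E.meanParam θ := by
    rw [ExpFamily.armMean, hθ]; split_ifs <;> rfl
  have := ExpFamily.isProbabilityMeasure_law h0 hθm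
  have hT := E.measurable_T
  have hκk : ∫ y, E.T y k ∂E.law θ = E.meanParam θ k := by
    have := hE.inner_meanParam h0 hθm (EuclideanSpace.single k 1)
    simpa [EuclideanSpace.inner_single_left] using this.symm
  have h := ae_tendsto_average_of_condLaw (P := P) (ℱ := hpol.pullFiltration)
    (X := fun t => X (t + 2)) (ν := E.law θ) (C := fun t => A (t + 2) ⁻¹' {j})
    (g := fun y => E.T y k)
    (fun t => (measurable_obs_pastField (by omega) le_rfl).mono
      (pastField_le_leaderField.trans leaderField_le_pullField) le_rfl)
    (fun t => by
      have h1 : Measurable[pullField A X U I (t + 1)] (A (t + 2)) :=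
        (comap_measurable (A (t + 2))).mono le_sup_right le_rfl
      exact h1 (measurableSet_singleton j))
    (fun t B hB => by
      filter_upwards [hpol.observe (t + 1) B hB] with ω hω (hj : A (t + 2) ω = j)
      exact hω.trans (by rw [hj]))
    (by fun_prop) ((memLp_piLp_iff.1 (hE.memLp_T h0 hθm)) k)
  filter_upwards [h] with ω hω
  refine tendsto_average_of_shift (hω.congr fun n => ?_)
  congr 1
  refine sum_congr rfl fun t _ => ?_
  rw [hκ, ← hκk]
  by_cases h : A (t + 2) ω = j <;> simp [Set.indicator, h]

/-- The sampling frequencies follow the averages of the drawing distributions. The coin discards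
the current arm with the same probability `γ` whatever it is, so arm `b` is entered at the rate
`γ * Q b` and left at the rate `γ` times its frequency, and up to a bounded term it is entered as
often as it is left. -/
lemma ae_tendsto_freq_sub [IsProbabilityMeasure P] (hγ₀ : 0 < γ) (hγ₁ : γ ≤ 1) (b : Fin K) :
    ∀ᵐ ω ∂P, Tendsto (fun n : ℕ => ExpFamily.freq (A · ω) n b
      - (n : ℝ)⁻¹ * ∑ t ∈ range n, Q (t + 1) ω b) atTop (𝓝 0) := by
  -- an arm drawn anew
  have h1 := ae_tendsto_average_indicator_sub (P := P) (ℱ := hpol.leaderFiltration)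
    (B := fun t => U (t + 2) ⁻¹' {true} ∩ A (t + 2) ⁻¹' {b})
    (p := fun t ω => γ * Q (t + 1) ω b)
    (fun t => by
      have hU : Measurable[leaderField A X U I (t + 2)] (U (t + 2)) :=
        (measurable_coin_pastField (by omega) le_rfl).mono pastField_le_leaderField le_rfl
      have hA : Measurable[leaderField A X U I (t + 2)] (A (t + 2)) :=
        (measurable_arm_pastField (by omega) le_rfl).mono pastField_le_leaderField le_rfl
      exact (hU (measurableSet_singleton true)).inter (hA (measurableSet_singleton b)))
    (fun t => hpol.draw (t + 1) (by omega) b)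
    (fun t ω => by
      have hq := hpol.Q_mem (t + 1) (by omega) ω
      have hle : Q (t + 1) ω b ≤ 1 := by
        rw [← hq.2]; exact single_le_sum (fun l _ => hq.1 l) (mem_univ b)
      exact ⟨mul_nonneg hγ₀.le (hq.1 b), mul_le_one₀ hγ₁ (hq.1 b) hle⟩)
  -- an arm discarded
  have h2 := ae_tendsto_average_indicator_sub (P := P) (ℱ := hpol.leaderFiltration)
    (B := fun t => A (t + 1) ⁻¹' {b} ∩ U (t + 2) ⁻¹' {true})
    (p := fun t => (A (t + 1) ⁻¹' {b}).indicator fun _ => γ)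
    (fun t => by
      have hU : Measurable[leaderField A X U I (t + 2)] (U (t + 2)) :=
        (measurable_coin_pastField (by omega) le_rfl).mono pastField_le_leaderField le_rfl
      have hA : Measurable[leaderField A X U I (t + 2)] (A (t + 1)) :=
        (measurable_arm_pastField (by omega) (by omega)).mono pastField_le_leaderField le_rfl
      exact (hA (measurableSet_singleton b)).inter (hU (measurableSet_singleton true)))
    (fun t => by
      have hA : Measurable[leaderField A X U I (t + 1)] (A (t + 1)) :=
        (measurable_arm_pastField (by omega) le_rfl).mono pastField_le_leaderField le_rfl
      have h3 := condExp_indicator (μ := P) (m := leaderField A X U I (t + 1))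
        (((integrable_const (1 : ℝ)).indicator
          (hpol.measurable_U (t + 2) (measurableSet_singleton true))))
        (hA (measurableSet_singleton b))
      rw [Set.indicator_indicator] at h3
      refine h3.trans ?_
      filter_upwards [hpol.coin (t + 1) (by omega)] with ω hω
      by_cases h : ω ∈ A (t + 1) ⁻¹' {b}
      · rw [Set.indicator_of_mem h, Set.indicator_of_mem h, hω]
      · rw [Set.indicator_of_notMem h, Set.indicator_of_notMem h])
    (fun t ω => by
      by_cases h : A (t + 1) ω = b <;> simp [h, hγ₀.le, hγ₁])
  have h3 : ∀ᵐ ω ∂P, ∀ t, U (t + 2) ω = false → A (t + 2) ω = A (t + 1) ω :=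
    ae_all_iff.2 fun t => hpol.stay (t + 1) (by omega)
  filter_upwards [h1, h2, h3] with ω h1 h2 h3
  set e : ℕ → ℝ := fun t => if A t ω = b then 1 else 0 with he
  have hcount : ∀ n, ∑ t ∈ range n, e (t + 1) = ExpFamily.count (A · ω) n b := by
    intro n
    rw [ExpFamily.count, card_eq_sum_ones, sum_filter, range_eq_Ico, sum_Ico_add' e 0 n 1, zero_add]
    have e2 : Ico 1 (n + 1) = Icc 1 n := by ext; simp
    rw [e2, Nat.cast_sum]
    exact sum_congr rfl fun t _ => by simp [he]
  have hstep : ∀ t, ((U (t + 2) ⁻¹' {true} ∩ A (t + 2) ⁻¹' {b}).indicator (fun _ => (1 : ℝ)) ω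
      - γ * Q (t + 1) ω b)
      - ((A (t + 1) ⁻¹' {b} ∩ U (t + 2) ⁻¹' {true}).indicator (fun _ => (1 : ℝ)) ω
        - (A (t + 1) ⁻¹' {b}).indicator (fun _ => γ) ω)
      = (e (t + 2) - e (t + 1)) + γ * (e (t + 1) - Q (t + 1) ω b) := by
    intro t
    have h4 := h3 t
    cases hU : U (t + 2) ω
    · by_cases hA : A (t + 1) ω = b <;> (simp [Set.indicator, he, h4 hU, hU, hA]; try ring)
    · by_cases hA : A (t + 1) ω = b <;> by_cases hA' : A (t + 2) ω = b <;>
        simp [Set.indicator, he, hU, hA, hA'] <;> ring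
  have h5 := h1.sub h2
  rw [sub_zero] at h5
  have h6 : Tendsto (fun n : ℕ => (n : ℝ)⁻¹ * (e (n + 1) - e 1)) atTop (𝓝 0) := by
    have h7 : Tendsto (fun n : ℕ => (n : ℝ)⁻¹ * 1) atTop (𝓝 0) := by
      simpa using tendsto_inv_atTop_nhds_zero_nat (𝕜 := ℝ)
    refine squeeze_zero_norm (fun n => ?_) h7
    rw [norm_mul, Real.norm_of_nonneg (by positivity)]
    gcongr
    simp only [he]
    split_ifs <;> simp
  have h8 := (h5.sub h6).const_mul γ⁻¹
  rw [sub_zero, mul_zero] at h8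
  refine h8.congr fun n => ?_
  rw [← mul_sub, ← mul_sub, ← sum_sub_distrib, sum_congr rfl fun t _ => hstep t,
    sum_add_distrib, sum_range_sub (fun t => e (t + 1)), ← mul_sum, sum_sub_distrib, hcount,
    ExpFamily.freq]
  field_simp
  ring

/-- Every arm is drawn anew with probability bounded below: estimates that exist are natural
parameters of the family, so nontrivial sampling applies to them. -/
lemma exists_le_Q (hE : E.Regular) (h0 : ¬ ∀ᵐ x ∂E.ref, E.h x = 0)
    (hsamp : E.NontrivialSampling K) (hc₀ : 0 < c₀) :
    ∃ c > 0, ∀ n, 1 ≤ n → ∀ ω b, c ≤ Q n ω b := by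
  obtain ⟨c, hc, h⟩ := hsamp
  refine ⟨min c c₀, lt_min hc.1 hc₀, fun n hn ω b => ?_⟩
  by_cases hok : E.EstimatesOK (A · ω) (X · ω) n (I n ω)
  · have hopt := hpol.Q_opt n hn ω hok
    obtain ⟨-, -, ⟨θ₁, ht1, e1⟩, ⟨θ₂, ht2, e2⟩, hne⟩ := hok
    rw [← e1, ← e2, hE.natParam_meanParam h0 ht1, hE.natParam_meanParam h0 ht2] at hne hopt
    exact (min_le_left _ _).trans (h _ θ₁ ht1 θ₂ ht2 hne _ hopt b)
  · exact (min_le_right _ _).trans (hpol.Q_default n hn ω hok b)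

end FollowsSluggishGLR

end Policy

theorem proposition5 {Ω S : Type*} [MeasurableSpace Ω] [MeasurableSpace S] {d K : ℕ}
    (hK : 3 ≤ K) (E : ExpFamily S d) (hE : E.Regular) (hsamp : E.NontrivialSampling K)
    (τ : EuclideanSpace ℝ (Fin d)) (n₀ : ℝ) (hprior : E.priorMass τ n₀ ≠ ∞)
    (γ c₀ : ℝ) (hγ₀ : 0 < γ) (hγ₁ : γ ≤ 1) (hc₀ : 0 < c₀)
    (i : Fin K) (η₁ η₂ : EuclideanSpace ℝ (Fin d))
    (hη₁ : η₁ ∈ E.natSpace) (hη₂ : η₂ ∈ E.natSpace) (hne : η₁ ≠ η₂)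
    (P : Measure Ω) [IsProbabilityMeasure P]
    (A : ℕ → Ω → Fin K) (X : ℕ → Ω → S) (U : ℕ → Ω → Bool) (I : ℕ → Ω → Fin K)
    (Q : ℕ → Ω → Fin K → ℝ)
    (hpol : FollowsSluggishGLR E τ n₀ γ c₀ i η₁ η₂ P A X U I Q) :
    ∀ᵐ ω ∂P, Tendsto (fun n : ℕ => E.GLR τ n₀ (A · ω) (X · ω) n i / ((n : ℝ) : EReal))
      atTop (𝓝 ((E.Dstar i η₁ η₂ : ℝ) : EReal)) := by
  have h0 := hE.not_ae_h_eq_zero hη₁ hne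
  have hS : E.natSpace.Nonempty := ⟨η₁, hη₁⟩
  obtain ⟨c, hc, hQc⟩ := hpol.exists_le_Q hE h0 hsamp hc₀
  filter_upwards [hpol.ae_mem_leaders, hpol.ae_h_ne_zero,
    ae_all_iff.2 fun b => hpol.ae_tendsto_freq_sub hγ₀ hγ₁ b,
    ae_all_iff.2 fun j => ae_all_iff.2 fun k =>
      hpol.ae_tendsto_average_obs hE h0 hη₁ hη₂ j k] with ω hlead hh hfq hobs
  have hc2 : 0 < c / 2 := half_pos hc
  have hfreq : ∀ᶠ n in atTop, ∀ l, c / 2 ≤ ExpFamily.freq (A · ω) n l :=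
    eventually_all.2 fun l => by
      filter_upwards [(hfq l).eventually (lt_mem_nhds (neg_lt_zero.2 hc2)),
        eventually_gt_atTop 0] with n hn hn0
      have h1 : c ≤ (n : ℝ)⁻¹ * ∑ t ∈ range n, Q (t + 1) ω l := by
        rw [le_inv_mul_iff₀ (by positivity)]
        simpa using sum_le_sum (s := range n) fun t _ => hQc (t + 1) (by omega) ω l
      linarith
  have hmean : ∀ l, Tendsto (fun n => E.oddMean (A · ω) (X · ω) n l) atTop
      (𝓝 (ExpFamily.armMean i (E.meanParam η₁) (E.meanParam η₂) l)) := fun l =>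
    ExpFamily.tendsto_oddMean hc2 (hfreq.mono fun n hn => hn l) (hobs l)
  have hI : ∀ᶠ n in atTop, I n ω = i := by
    filter_upwards [hE.eventually_leaders h0 hK hη₁ hη₂ hh hc2 hfreq hmean hne hprior,
      eventually_ge_atTop 1] with n hn hn1 using hn _ (hlead n hn1)
  have hok := hE.eventually_estimatesOK h0 hK hη₁ hη₂ hc2 hfreq hmean hne
  have hmem : ∀ y ∈ E.meanParam '' E.natSpace,
      E.natParam y ∈ E.natSpace ∧ E.meanParam (E.natParam y) = y := by
    rintro _ ⟨θ, hθ, rfl⟩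
    rw [hE.natParam_meanParam h0 hθ]
    exact ⟨hθ, rfl⟩
  have hodd : Tendsto (fun n => E.oddMean (A · ω) (X · ω) n i) atTop (𝓝 (E.meanParam η₁)) := by
    simpa [ExpFamily.armMean] using hmean i
  have hQ : Tendsto (fun n => E.allocValue i η₁ η₂ (Q n ω)) atTop (𝓝 (E.Dstar i η₁ η₂)) := by
    refine hE.tendsto_allocValue_of_isOptAlloc h0 hK hη₁ hη₂
      (θ₁ := fun n => E.natParam (E.oddMean (A · ω) (X · ω) n i))
      (θ₂ := fun n => E.natParam (E.restMean (A · ω) (X · ω) n i))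
      (hok.mono fun n hn => (hmem _ hn.2.2.1).1) (hok.mono fun n hn => (hmem _ hn.2.2.2.1).1)
      (hodd.congr' (hok.mono fun n hn => (hmem _ hn.2.2.1).2.symm))
      ((ExpFamily.tendsto_restMean hK hc2 hfreq hmean).congr'
        (hok.mono fun n hn => (hmem _ hn.2.2.2.1).2.symm)) ?_ ?_
    · filter_upwards [eventually_ge_atTop 1] with n hn l using hc.trans_le (hQc n hn ω l)
    · filter_upwards [hok, hI, eventually_ge_atTop 1] with n h1 h2 hn
      have h3 := hpol.Q_opt n hn ω
      rw [h2] at h3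
      exact h3 h1
  refine hE.tendsto_GLR_div h0 hK hη₁ hη₂ hh hc2 hfreq hmean hprior ?_
  -- the distributions `Q n` are constrained from time `1` on only
  refine ExpFamily.tendsto_allocValue_of_average hK hS (q := fun t => Q (t + 1) ω)
    (fun t => hpol.Q_mem _ (by omega) ω) hc (fun t l => hQc _ (by omega) ω l)
    (hQ.comp (tendsto_add_atTop_nat 1)) ?_ hfq
  filter_upwards [eventually_gt_atTop 0] with n hn using ExpFamily.freq_mem_stdSimplex _ hn
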